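/- Let $X$ be a Banach space. Let $L_2^X$ be the space of all (strongly) measurable functions $f:[0,1]\to X$ with $\|f\|_2:=\big(\int_0^1\|f(t)\|^2\,dt\big)^{1/2}<\infty$. Let $r_1:\mathbb R\to\{1,-1\}$ be equal to $1$ on $[0,\tfrac12)+\mathbb Z$ and to $-1$ on $[\tfrac12,1)+\mathbb Z$, and let $r_{i+1}(t):=r_1(2^it)$ for $i\ge 0$. For an integer $n\ge0$ with binary expansion $n=\sum_{i\ge0}n_i2^i$, $n_i\in\{0,1\}$, let $w_n:=\prod_{i\ge0}r_{i+1}^{n_i}$ be the $n$-th Walsh function. For $f\in L_2^X$ let $$S_n(f):=\sum_{i=0}^{n-1}\langle f,w_i\rangle w_i,\qquad \langle f,w_i\rangle:=\int_0^1 f(t)w_i(t)\,dt\in X .$$ The space $X$ has the UMD property if there is a constant $c\ge0$ such that $$\Big\|\sum_{i=0}^n\varepsilon_i\,dM_i\Big\|_2\le c\,\Big\|\sum_{i=0}^n dM_i\Big\|_2,\qquad dM_i:=M_{i+1}-M_i,$$ for all martingales $(M_0,M_1,\dots)$ with values in $X$ (on any probability space, with respect to any filtration), all signs $\varepsilon_i=\pm1$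 and all $n\in\mathbb N$. Here $\|\cdot\|_2$ is the $L_2$ norm over the probability space, with values in $[0,\infty]$. **Corollary.** The following conditions are equivalent. 1. $\|f-S_n(f)\|_2\to0$ as $n\to\infty$ for all $f\in L_2^X$. 2. $X$ has the UMD property. -/

import Mathlib

open MeasureTheory Filter Topology
open scoped ENNReal NNReal

universe u v

namespace WalshUMD

noncomputable section

/-- The first Rademacher function `r₁`: the `1`-periodic function on `ℝ` equal to `1` on
`[0, 1/2) + ℤ` and to `-1` on `[1/2, 1) + ℤ`. -/
def rademacherOne (t : ℝ) : ℝ :=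
  if Int.fract t < 1 / 2 then 1 else -1

/-- The Rademacher function `r_{i+1}(t) = r₁(2^i t)`, for `i = 0, 1, 2, …`. -/
def rademacherSucc (i : ℕ) (t : ℝ) : ℝ :=
  rademacherOne (2 ^ i * t)

/-- The Walsh function `w_n = ∏_i r_{i+1}^{n_i}` in the Paley enumeration, where `n = ∑_i n_i 2^i`
is the binary expansion of `n`. The product runs over the binary digits of `n`: for `i ≥ n.size`
the digit `n_i` is `0`. -/
def walsh (n : ℕ) (t : ℝ) : ℝ :=
  ∏ i ∈ Finset.range n.size, rademacherSucc i t ^ (n.testBit i).toNat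

/-- The Lebesgue measure of the interval `[0, 1]`, as a measure on `ℝ`. -/
def unitMeasure : Measure ℝ :=
  volume.restrict (Set.Icc 0 1)

variable {X : Type u} [NormedAddCommGroup X] [NormedSpace ℝ X]

/-- The Walsh coefficient `⟨f, w_i⟩ = ∫₀¹ f(t) w_i(t) dt`, a Bochner integral in `X`. -/
def walshCoeff (f : ℝ → X) (i : ℕ) : X :=
  ∫ t, walsh i t • f t ∂unitMeasure

/-- The `n`-th Walsh partial sum `S_n(f) = ∑_{i=0}^{n-1} ⟨f, w_i⟩ w_i`. -/
def walshPartialSum (n : ℕ) (f : ℝ → X) (t : ℝ) : X :=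
  ∑ i ∈ Finset.range n, walsh i t • walshCoeff f i

/-- The UMD property of a Banach space `X`: there is a constant `c ≥ 0` such that
`‖∑_{i=0}^n ε_i dM_i‖₂ ≤ c ‖∑_{i=0}^n dM_i‖₂`, with `dM_i = M_{i+1} - M_i`, for all martingales
`(M_0, M_1, …)` with values in `X`, over any filtration of any probability space, for all signs
`ε_i = ±1` and for all `n`. The norms are taken in `[0, ∞]`. -/
def HasUMD (X : Type u) [NormedAddCommGroup X] [NormedSpace ℝ X] [CompleteSpace X] : Prop :=
  ∃ c : ℝ≥0, ∀ (Ω : Type v) (mΩ : MeasurableSpace Ω) (P : Measure Ω) (_ : IsProbabilityMeasure P)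
    (ℱ : Filtration ℕ mΩ) (M : ℕ → Ω → X), Martingale M ℱ P →
    ∀ (ε : ℕ → ℝ), (∀ i, ε i = 1 ∨ ε i = -1) → ∀ n : ℕ,
      eLpNorm (fun ω => ∑ i ∈ Finset.range (n + 1), ε i • (M (i + 1) ω - M i ω)) 2 P ≤
        c * eLpNorm (fun ω => ∑ i ∈ Finset.range (n + 1), (M (i + 1) ω - M i ω)) 2 P

end

end WalshUMD

/-! ### Walsh functions, xor of indices and the Dirichlet kernel. -/

namespace WalshUMD

/-! Walsh functions are characters: by `walsh_mul_walsh`, multiplying them is taking the xor of the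
indices. The numbers n xor i with i < n fill exactly the blocks [2^k, 2^(k+1)) over the binary
digits n_k = 1. Hence w_n S_n(w_n g) is the sum of S_{2^(k+1)} g - S_{2^k} g over these k
(`walsh_smul_walshPartialSum`). Since S_{2^k} is the conditional expectation onto the dyadic cells
of level k, these are dyadic martingale differences. As |w_n| = 1, and digits and signs are related
by η_k = 2 n_k - 1, a uniform L₂ bound for the S_n amounts to one for sign transforms of dyadic
martingales (`WalshBound.dyadicSignBound`, `DyadicSignBound.walshBound`).

Convergence gives the uniform bound by Banach-Steinhaus. Conversely, S_n g = g almost everywhere for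
n ≥ 2^k if g is dyadic of level k, and such g are dense, so the bound gives convergence. UMD yields
the sign bound by applying it to the dyadic martingale.

It remains to pass from dyadic martingales to all martingales. Signs constant on blocks of m dyadic
levels cover martingales driven by independent uniform choices among 2^m points
(`DyadicSignBound.treeBound`). Their images have transition probabilities in 2^(-m) ℕ, and limits
reach all finite transition probabilities, because at fixed depth the inequality is continuous in
the weights (`TreeBound.of_uniformKernel`). Up to a finite time, an arbitrary L₂ martingale is
approximated by one generated by a finitely valued sequence (`eLpNorm_transform_le_of_treeBound`).
-/

theorem rademacherOne_eq_one_or (t : ℝ) : rademacherOne t = 1 ∨ rademacherOne t = -1 := by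
  unfold rademacherOne; split_ifs <;> simp

theorem rademacherSucc_eq_one_or (i : ℕ) (t : ℝ) :
    rademacherSucc i t = 1 ∨ rademacherSucc i t = -1 :=
  rademacherOne_eq_one_or _

theorem rademacherSucc_mul_self (i : ℕ) (t : ℝ) :
    rademacherSucc i t * rademacherSucc i t = 1 := by
  rcases rademacherSucc_eq_one_or i t with h | h <;> simp [h]

theorem rademacherOne_eq_ite_even (t : ℝ) :
    rademacherOne t = if Even ⌊2 * t⌋ then 1 else -1 := by
  have h0 := Int.floor_add_fract t
  have h1 := Int.fract_nonneg t
  have h2 := Int.fract_lt_one t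
  unfold rademacherOne
  by_cases h : Int.fract t < 1 / 2
  · have : ⌊2 * t⌋ = 2 * ⌊t⌋ := by
      rw [Int.floor_eq_iff]; push_cast; constructor <;> linarith
    rw [if_pos h, this, if_pos (even_two_mul _)]
  · have : ⌊2 * t⌋ = 2 * ⌊t⌋ + 1 := by
      rw [Int.floor_eq_iff]; push_cast; constructor <;> linarith
    rw [if_neg h, this, if_neg (by simp)]

theorem rademacherSucc_eq_ite_even (i : ℕ) (t : ℝ) :
    rademacherSucc i t = if Even ⌊2 ^ (i + 1) * t⌋ then 1 else -1 := by
  rw [rademacherSucc, rademacherOne_eq_ite_even, pow_succ', mul_assoc]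

/-- The floor of a product with `p * q` determines the floor of the product with `p`. -/
theorem floor_natCast_mul_ediv (q : ℕ) (x : ℝ) : ⌊(q : ℝ) * x⌋ / (q : ℤ) = ⌊x⌋ ∨ q = 0 := by
  rcases Nat.eq_zero_or_pos q with rfl | hq
  · exact Or.inr rfl
  · left
    have hq' : (0 : ℝ) < q := by exact_mod_cast hq
    have h1 := Int.floor_le x
    have h2 := Int.lt_floor_add_one x
    have h3 : (q : ℤ) * ⌊x⌋ ≤ ⌊(q : ℝ) * x⌋ := by
      rw [Int.le_floor]; push_cast; gcongr
    have h4 : ⌊(q : ℝ) * x⌋ < (q : ℤ) * (⌊x⌋ + 1) := by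
      rw [Int.floor_lt]; push_cast; gcongr
    have hqz : (0 : ℤ) < q := by exact_mod_cast hq
    apply le_antisymm
    · have := Int.ediv_lt_of_lt_mul hqz (h4.trans_eq (mul_comm _ _))
      omega
    · rw [Int.le_ediv_iff_mul_le hqz, mul_comm]; exact h3

/-- Passing to the parent dyadic cell is integer halving; this is what makes the dyadic σ-algebras
nested. -/
theorem floor_two_pow_succ_ediv (k : ℕ) (t : ℝ) : ⌊2 ^ (k + 1) * t⌋ / 2 = ⌊2 ^ k * t⌋ := by
  have := floor_natCast_mul_ediv 2 (2 ^ k * t)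
  simp only [OfNat.ofNat_ne_zero, or_false] at this
  rw [pow_succ', mul_assoc]
  exact_mod_cast this

theorem floor_two_pow_eq_of_le {j k : ℕ} (hjk : j ≤ k) {s t : ℝ}
    (h : ⌊2 ^ k * s⌋ = ⌊2 ^ k * t⌋) : ⌊2 ^ j * s⌋ = ⌊2 ^ j * t⌋ := by
  induction k, hjk using Nat.le_induction with
  | base => exact h
  | succ k _ ih => exact ih (by rw [← floor_two_pow_succ_ediv, h, floor_two_pow_succ_ediv])

theorem rademacherSucc_congr {i k : ℕ} (hik : i < k) {s t : ℝ}
    (h : ⌊2 ^ k * s⌋ = ⌊2 ^ k * t⌋) : rademacherSucc i s = rademacherSucc i t := by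
  rw [rademacherSucc_eq_ite_even, rademacherSucc_eq_ite_even,
    floor_two_pow_eq_of_le (Nat.succ_le_of_lt hik) h]

theorem walsh_eq_prod_range {n K : ℕ} (h : n < 2 ^ K) (t : ℝ) :
    walsh n t = ∏ i ∈ Finset.range K, rademacherSucc i t ^ (n.testBit i).toNat := by
  unfold walsh
  apply Finset.prod_subset
  · intro i hi
    have := Nat.size_le.2 h
    simp at *; omega
  · intro i _ hi
    have : n < 2 ^ i := Nat.size_le.1 (by simpa using hi)
    simp [Nat.testBit_lt_two_pow this]

theorem walsh_zero (t : ℝ) : walsh 0 t = 1 := by simp [walsh]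

/-- Rademacher functions square to 1, so digits add modulo 2. -/
theorem walsh_mul_walsh (m n : ℕ) (t : ℝ) : walsh m t * walsh n t = walsh (m ^^^ n) t := by
  obtain ⟨K, hm, hn⟩ : ∃ K, m < 2 ^ K ∧ n < 2 ^ K :=
    ⟨m + n, lt_of_le_of_lt (by omega) (Nat.lt_two_pow_self (n := m + n)),
      lt_of_le_of_lt (by omega) (Nat.lt_two_pow_self (n := m + n))⟩
  rw [walsh_eq_prod_range hm, walsh_eq_prod_range hn,
    walsh_eq_prod_range (Nat.xor_lt_two_pow hm hn), ← Finset.prod_mul_distrib]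
  refine Finset.prod_congr rfl fun i _ => ?_
  rw [Nat.testBit_xor]
  cases m.testBit i <;> cases n.testBit i <;> simp [rademacherSucc_mul_self]

theorem walsh_mul_self (n : ℕ) (t : ℝ) : walsh n t * walsh n t = 1 := by
  rw [walsh_mul_walsh, Nat.xor_self, walsh_zero]

theorem walsh_eq_one_or (n : ℕ) (t : ℝ) : walsh n t = 1 ∨ walsh n t = -1 :=
  mul_self_eq_one_iff.1 (walsh_mul_self n t)

theorem abs_walsh (n : ℕ) (t : ℝ) : |walsh n t| = 1 := by
  rcases walsh_eq_one_or n t with h | h <;> simp [h]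

theorem walsh_congr {n k : ℕ} (hn : n < 2 ^ k) {s t : ℝ}
    (h : ⌊2 ^ k * s⌋ = ⌊2 ^ k * t⌋) : walsh n s = walsh n t := by
  rw [walsh_eq_prod_range hn, walsh_eq_prod_range hn]
  refine Finset.prod_congr rfl fun i hi => ?_
  rw [rademacherSucc_congr (Finset.mem_range.1 hi) h]

theorem walsh_two_pow_add {K m : ℕ} (hm : m < 2 ^ K) (t : ℝ) :
    walsh (2 ^ K + m) t = rademacherSucc K t * walsh m t := by
  rw [walsh_eq_prod_range (K := K + 1) (by rw [pow_succ]; omega), walsh_eq_prod_range hm,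
    Finset.prod_range_succ, mul_comm]
  congr 1
  · simp [Nat.testBit_two_pow_add_eq, Nat.testBit_lt_two_pow hm]
  · refine Finset.prod_congr rfl fun i hi => ?_
    rw [Nat.testBit_two_pow_add_gt (Finset.mem_range.1 hi)]

/-- The Walsh–Dirichlet kernel of order `2^k` as a Riesz product. -/
theorem sum_walsh_mul_walsh (k : ℕ) (s t : ℝ) :
    ∑ m ∈ Finset.range (2 ^ k), walsh m s * walsh m t =
      ∏ i ∈ Finset.range k, (1 + rademacherSucc i s * rademacherSucc i t) := by
  induction k with
  | zero => simp [walsh_zero]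
  | succ k ih =>
    rw [Finset.prod_range_succ, ← ih, pow_succ, mul_two, Finset.sum_range_add, mul_add, mul_one,
      Finset.sum_mul]
    congr 1
    refine Finset.sum_congr rfl fun m hm => ?_
    rw [walsh_two_pow_add (Finset.mem_range.1 hm), walsh_two_pow_add (Finset.mem_range.1 hm)]
    ring

/-- The Walsh–Dirichlet kernel of order `2^k` is `2^k` times the indicator of the diagonal dyadic
squares. -/
theorem sum_walsh_mul_walsh_eq_ite (k : ℕ) {s t : ℝ} (h0 : ⌊s⌋ = ⌊t⌋) :
    ∑ m ∈ Finset.range (2 ^ k), walsh m s * walsh m t =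
      if ⌊2 ^ k * s⌋ = ⌊2 ^ k * t⌋ then 2 ^ k else 0 := by
  rw [sum_walsh_mul_walsh]
  induction k with
  | zero => simp [h0]
  | succ k ih =>
    rw [Finset.prod_range_succ, ih, rademacherSucc_eq_ite_even, rademacherSucc_eq_ite_even]
    have hs := floor_two_pow_succ_ediv k s
    have ht := floor_two_pow_succ_ediv k t
    generalize ⌊2 ^ (k + 1) * s⌋ = a at *
    generalize ⌊2 ^ (k + 1) * t⌋ = b at *
    rw [← hs, ← ht]
    by_cases hab : a = b
    · subst hab
      by_cases ha : Even a <;> simp [ha, pow_succ] <;> ring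
    · by_cases h2 : a / 2 = b / 2
      -- Distinct children of one cell have opposite parity, so the new Riesz factor vanishes.
      · have : Even a ↔ ¬ Even b := by
          rw [Int.even_iff, Int.even_iff]; omega
        by_cases hb : Even b <;> simp [hab, this, hb]
      · simp [hab, h2]

theorem two_pow_add_xor_two_pow_add {K m n : ℕ} (hm : m < 2 ^ K) (hn : n < 2 ^ K) :
    (2 ^ K + m) ^^^ (2 ^ K + n) = m ^^^ n := by
  have h1 := Nat.two_pow_add_eq_or_of_lt hm 1
  have h2 := Nat.two_pow_add_eq_or_of_lt hn 1
  rw [mul_one] at h1 h2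
  rw [h1, h2]
  refine Nat.eq_of_testBit_eq fun i => ?_
  simp only [Nat.testBit_xor, Nat.testBit_or, Nat.testBit_two_pow]
  by_cases h : K = i
  · subst h; simp [Nat.testBit_lt_two_pow hm, Nat.testBit_lt_two_pow hn]
  · simp [h]

theorem two_pow_add_xor {K m n : ℕ} (hm : m < 2 ^ K) (hn : n < 2 ^ K) :
    (2 ^ K + m) ^^^ n = 2 ^ K + (m ^^^ n) := by
  have h1 := Nat.two_pow_add_eq_or_of_lt hm 1
  have h2 := Nat.two_pow_add_eq_or_of_lt (Nat.xor_lt_two_pow hm hn) 1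
  rw [mul_one] at h1 h2
  rw [h1, h2]
  refine Nat.eq_of_testBit_eq fun i => ?_
  simp only [Nat.testBit_xor, Nat.testBit_or, Nat.testBit_two_pow]
  by_cases h : K = i
  · subst h; simp [Nat.testBit_lt_two_pow hm, Nat.testBit_lt_two_pow hn]
  · simp [h]

/-- Xor with n is an involution of [0, 2^K). -/
theorem sum_range_two_pow_xor {Y : Type*} [AddCommMonoid Y] {K n : ℕ} (hn : n < 2 ^ K)
    (a : ℕ → Y) :
    ∑ i ∈ Finset.range (2 ^ K), a (n ^^^ i) = ∑ i ∈ Finset.range (2 ^ K), a i := by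
  refine Finset.sum_nbij' (fun i => n ^^^ i) (fun i => n ^^^ i) ?_ ?_ ?_ ?_ ?_ <;>
    simp +contextual [Nat.xor_lt_two_pow hn]

/-- Summation over `{n xor i | i < n}` in terms of the dyadic blocks selected by the digits
of `n`. -/
theorem sum_range_xor {Y : Type*} [AddCommGroup Y] (a : ℕ → Y) {K n : ℕ} (hn : n < 2 ^ K) :
    ∑ i ∈ Finset.range n, a (n ^^^ i) =
      ∑ k ∈ Finset.range K, if n.testBit k then
        ∑ m ∈ Finset.range (2 ^ (k + 1)), a m - ∑ m ∈ Finset.range (2 ^ k), a m else 0 := by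
  induction K generalizing n with
  | zero => simp at hn; simp [hn]
  | succ K ih =>
    rw [Finset.sum_range_succ]
    rcases lt_or_ge n (2 ^ K) with h | h
    · rw [ih h]; simp [Nat.testBit_lt_two_pow h]
    · obtain ⟨n', rfl⟩ := Nat.exists_eq_add_of_le h
      have hn' : n' < 2 ^ K := by rw [pow_succ] at hn; omega
      -- With n = 2^K + n', the indices i < 2^K keep the top bit and sweep the whole block [2^K,
      -- 2^(K+1)). For the remaining n' indices the top bits cancel, which leaves the sum for n'.
      rw [Finset.sum_range_add, add_comm]
      congr 1
      · rw [Finset.sum_congr rfl (g := fun i => a (n' ^^^ i)), ih hn']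
        · refine Finset.sum_congr rfl fun k hk => ?_
          rw [Nat.testBit_two_pow_add_gt (Finset.mem_range.1 hk)]
        · intro i hi
          rw [two_pow_add_xor_two_pow_add hn' ((Finset.mem_range.1 hi).trans hn')]
      · rw [Nat.testBit_two_pow_add_eq, Nat.testBit_lt_two_pow hn', pow_succ, mul_two,
          Finset.sum_range_add]
        simp only [Bool.not_false, if_true, add_sub_cancel_left]
        rw [← sum_range_two_pow_xor hn' (fun i => a (2 ^ K + i))]
        refine Finset.sum_congr rfl fun i hi => ?_
        rw [two_pow_add_xor hn' (Finset.mem_range.1 hi)]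

variable {X : Type u} [NormedAddCommGroup X] [NormedSpace ℝ X]

/-- Modulated by `w_n`, the `n`-th Walsh partial sum becomes the sum of the dyadic martingale
differences selected by the digits of `n`. -/
theorem walsh_smul_walshPartialSum (g : ℝ → X) {K n : ℕ} (hn : n < 2 ^ K) (t : ℝ) :
    walsh n t • walshPartialSum n (fun s => walsh n s • g s) t =
      ∑ k ∈ Finset.range K, if n.testBit k then
        walshPartialSum (2 ^ (k + 1)) g t - walshPartialSum (2 ^ k) g t else 0 := by
  have := sum_range_xor (fun m => walsh m t • walshCoeff g m) hn
  simp only [walshPartialSum]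
  rw [← this, Finset.smul_sum]
  refine Finset.sum_congr rfl fun i _ => ?_
  rw [smul_smul, walsh_mul_walsh]
  congr 1
  simp only [walshCoeff, smul_smul]
  congr 1; ext s
  rw [Nat.xor_comm, ← walsh_mul_walsh]

end WalshUMD

namespace WalshUMD

/-! ### Conditional expectations given a countably valued map. -/

section CondExp

variable {Ω : Type*} {mΩ : MeasurableSpace Ω} {P : Measure Ω}
  {X : Type*} [NormedAddCommGroup X] [NormedSpace ℝ X]

/-- A function with values in a countable set is measurable with respect to the discrete
σ-algebra as soon as its fibres are measurable. -/
theorem comap_top_le_of_fibers {L : Type*} [Countable L] {m : MeasurableSpace Ω} {Z : Ω → L}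
    (hZ : ∀ l, MeasurableSet[m] (Z ⁻¹' {l})) : MeasurableSpace.comap Z ⊤ ≤ m := by
  rintro _ ⟨T, -, rfl⟩
  rw [← Set.biUnion_preimage_singleton]
  exact MeasurableSet.biUnion T.to_countable fun l _ => hZ l

omit [NormedSpace ℝ X] in
theorem stronglyMeasurable_comp_of_fibers {L : Type*} [Countable L] {m : MeasurableSpace Ω}
    {Z : Ω → L} (hZ : ∀ l, MeasurableSet[m] (Z ⁻¹' {l})) (G : L → X) :
    StronglyMeasurable[m] (fun ω => G (Z ω)) := by
  let _ : MeasurableSpace L := ⊤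
  have h1 : Measurable[m] Z := measurable_iff_comap_le.2 (comap_top_le_of_fibers hZ)
  have h2 : StronglyMeasurable G := StronglyMeasurable.of_discrete
  exact h2.comp_measurable h1

/-- A function of a countably valued `Z` having the same integrals as `f` over the fibres of `Z`
is the conditional expectation of `f` given `Z`. -/
theorem ae_eq_condExp_comap_of_fibers [CompleteSpace X] [IsFiniteMeasure P]
    {L : Type*} [Countable L] {Z : Ω → L} (hZ : ∀ l, MeasurableSet (Z ⁻¹' {l}))
    {f g : Ω → X} (hf : Integrable f P) (hg : Integrable g P)
    (hgm : AEStronglyMeasurable[MeasurableSpace.comap Z ⊤] g P)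
    (hfg : ∀ l, ∫ ω in Z ⁻¹' {l}, g ω ∂P = ∫ ω in Z ⁻¹' {l}, f ω ∂P) :
    g =ᵐ[P] P[f | MeasurableSpace.comap Z ⊤] := by
  refine ae_eq_condExp_of_forall_setIntegral_eq (comap_top_le_of_fibers hZ) hf
    (fun s _ _ => hg.integrableOn) ?_ hgm
  rintro _ ⟨T, -, rfl⟩ -
  -- Every set of the generated σ-algebra is a countable disjoint union of fibres, so integrals over
  -- fibres determine all the others.
  have key : ∀ {u : Ω → X}, Integrable u P →
      HasSum (fun l : T => ∫ ω in Z ⁻¹' {(l : L)}, u ω ∂P) (∫ ω in Z ⁻¹' T, u ω ∂P) := by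
    intro u hu
    have hT : Z ⁻¹' T = ⋃ l : T, Z ⁻¹' {(l : L)} := by ext; simp
    rw [hT]
    refine hasSum_integral_iUnion (fun l => hZ l) ?_ hu.integrableOn
    intro a b hab
    refine Disjoint.preimage Z ?_
    simpa [Subtype.ext_iff] using fun h => hab (Subtype.ext h)
  have h1 := key hg
  simp only [hfg] at h1
  exact h1.unique (key hf)

omit [NormedSpace ℝ X] in
theorem memLp_comp_of_mem_finset [IsFiniteMeasure P] {L : Type*} [Countable L] {Z : Ω → L}
    (hZ : ∀ l, MeasurableSet (Z ⁻¹' {l})) (D : Finset L) (hD : ∀ᵐ ω ∂P, Z ω ∈ D) (G : L → X)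
    (p : ℝ≥0∞) : MemLp (fun ω => G (Z ω)) p P := by
  refine MemLp.of_bound (stronglyMeasurable_comp_of_fibers hZ G).aestronglyMeasurable
    (∑ l ∈ D, ‖G l‖) ?_
  filter_upwards [hD] with ω hω
  exact Finset.single_le_sum (f := fun l => ‖G l‖) (fun _ _ => norm_nonneg _) hω

theorem setIntegral_comp_of_mem_finset [CompleteSpace X] [IsFiniteMeasure P] {L : Type*}
    {Z : Ω → L}
    (hZ : ∀ l, MeasurableSet (Z ⁻¹' {l})) (D : Finset L) (hD : ∀ᵐ ω ∂P, Z ω ∈ D) (G : L → X)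
    (S : Set Ω) :
    ∫ ω in S, G (Z ω) ∂P = ∑ l ∈ D, P.real (S ∩ Z ⁻¹' {l}) • G l := by
  classical
  have h : ∀ᵐ ω ∂(P.restrict S),
      G (Z ω) = ∑ l ∈ D, (Z ⁻¹' {l}).indicator (fun _ => G l) ω := by
    filter_upwards [ae_restrict_of_ae hD] with ω hω
    simp [Set.indicator_apply, hω]
  rw [integral_congr_ae h, integral_finsetSum]
  · refine Finset.sum_congr rfl fun l _ => ?_
    rw [integral_indicator_const _ (hZ l), measureReal_restrict_apply (hZ l), Set.inter_comm]
  · intro l _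
    exact (integrable_const _).indicator (hZ l)

omit [NormedSpace ℝ X] in
theorem eLpNorm_two_eq_ofReal_sqrt {f : Ω → X} (hf : MemLp f 2 P) :
    eLpNorm f 2 P = ENNReal.ofReal (Real.sqrt (∫ ω, ‖f ω‖ ^ 2 ∂P)) := by
  rw [hf.eLpNorm_eq_integral_rpow_norm (by norm_num) (by norm_num), Real.sqrt_eq_rpow]
  simp

end CondExp

/-! ### Martingales on finitely branching trees and processes realizing them. -/

section Tree

variable {A : Type*} [Fintype A] {X : Type*} [NormedAddCommGroup X] [NormedSpace ℝ X]

/-- The one-step mean of a function of histories (newest entry first) for the transition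
weights `κ`. -/
def stepMean (κ : List A → A → ℝ) (Ψ : List A → X) (h : List A) : X :=
  ∑ b, κ h b • Ψ (b :: h)

/-- The martingale on the tree of histories with terminal value `F` at time `N`. -/
def treeMart (κ : List A → A → ℝ) (N : ℕ) (F : List A → X) (h : List A) : X :=
  (stepMean κ)^[N - h.length] F h

/-- The transform of a function of histories by a sequence of multipliers. -/
def treeTransform (ε : ℕ → ℝ) (M : List A → X) : List A → X
  | [] => 0
  | b :: h => treeTransform ε M h + ε h.length • (M (b :: h) - M h)

/-- The `L₂` inequality for transforms by signs, with constant `c`, of the `X`-valued martingales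
on the tree of histories with transition weights `κ`. -/
def TreeBound (X : Type*) [NormedAddCommGroup X] [NormedSpace ℝ X] (c : ℝ)
    (κ : List A → A → ℝ) : Prop :=
  ∀ (N : ℕ) (F : List A → X) (ε : ℕ → ℝ), (∀ i, ε i = 1 ∨ ε i = -1) →
    (stepMean κ)^[N] (fun h => ‖treeTransform ε (treeMart κ N F) h‖ ^ 2) [] ≤
      c ^ 2 * (stepMean κ)^[N] (fun h => ‖F h - treeMart κ N F []‖ ^ 2) []

variable {Ω : Type*} {mΩ : MeasurableSpace Ω}

/-- The process `hist` of growing histories has transition weights `κ`, and each value of `hist i`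
is, up to null sets, an atom of `𝒢 i`. -/
structure IsTreeProcess (P : Measure Ω) (𝒢 : Filtration ℕ mΩ) (κ : List A → A → ℝ)
    (hist : ℕ → Ω → List A) : Prop where
  zero : ∀ ω, hist 0 ω = []
  cons : ∀ i ω, ∃ b, hist (i + 1) ω = b :: hist i ω
  meas : ∀ i h, MeasurableSet[𝒢 i] (hist i ⁻¹' {h})
  -- Null sets must be allowed: base-`2^m` digits do not distinguish t from t + 1, while the dyadic
  -- σ-algebra on ℝ does.
  atom : ∀ i S h, MeasurableSet[𝒢 i] S →
    P (S ∩ hist i ⁻¹' {h}) = 0 ∨ P (hist i ⁻¹' {h} \ S) = 0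
  prob : ∀ i b h, P.real (hist (i + 1) ⁻¹' {b :: h}) = κ h b * P.real (hist i ⁻¹' {h})

/-- The histories of length `i`. -/
noncomputable def histories (A : Type*) [Fintype A] (i : ℕ) : Finset (List A) :=
  (List.finite_length_eq A i).toFinset

theorem mem_histories {i : ℕ} {h : List A} : h ∈ histories A i ↔ h.length = i := by
  simp [histories]

omit [NormedSpace ℝ X] in
theorem sum_histories_succ (i : ℕ) (a : List A → X) :
    ∑ h ∈ histories A (i + 1), a h = ∑ h ∈ histories A i, ∑ b, a (b :: h) := by
  rw [← Finset.sum_product']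
  symm
  refine Finset.sum_bij (fun x _ => x.2 :: x.1) ?_ ?_ ?_ ?_
  · simp [mem_histories]
  · rintro ⟨h, b⟩ _ ⟨h', b'⟩ _ heq
    simp at heq; simp [heq]
  · intro h hh
    rw [mem_histories] at hh
    obtain ⟨b, t, rfl⟩ := List.exists_cons_of_length_eq_add_one hh
    exact ⟨(t, b), by simpa [mem_histories] using hh, rfl⟩
  · simp

namespace IsTreeProcess

variable {P : Measure Ω} {𝒢 : Filtration ℕ mΩ} {κ : List A → A → ℝ} {hist : ℕ → Ω → List A}

omit [Fintype A] in
theorem length_eq (hT : IsTreeProcess P 𝒢 κ hist) (i : ℕ) (ω : Ω) : (hist i ω).length = i := by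
  induction i with
  | zero => simp [hT.zero]
  | succ i ih => obtain ⟨b, hb⟩ := hT.cons i ω; simp [hb, ih]

omit [Fintype A] in
theorem meas' (hT : IsTreeProcess P 𝒢 κ hist) (i : ℕ) (h : List A) :
    MeasurableSet (hist i ⁻¹' {h}) :=
  𝒢.le i _ (hT.meas i h)

theorem mem_hist (hT : IsTreeProcess P 𝒢 κ hist) (i : ℕ) :
    ∀ᵐ ω ∂P, hist i ω ∈ histories A i :=
  Eventually.of_forall fun ω => mem_histories.2 (hT.length_eq i ω)

omit [NormedSpace ℝ X] in
theorem memLp [IsFiniteMeasure P] (hT : IsTreeProcess P 𝒢 κ hist) (i : ℕ) (Ψ : List A → X)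
    (p : ℝ≥0∞) : MemLp (fun ω => Ψ (hist i ω)) p P := by
  have := Fintype.toEncodable A
  exact memLp_comp_of_mem_finset (hT.meas' i) _ (hT.mem_hist i) Ψ p

omit [NormedSpace ℝ X] in
theorem integrable [IsFiniteMeasure P] (hT : IsTreeProcess P 𝒢 κ hist) (i : ℕ)
    (Ψ : List A → X) : Integrable (fun ω => Ψ (hist i ω)) P :=
  memLp_one_iff_integrable.1 (hT.memLp i Ψ 1)

omit [NormedSpace ℝ X] in
theorem stronglyMeasurable (hT : IsTreeProcess P 𝒢 κ hist) (i : ℕ) (Ψ : List A → X) :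
    StronglyMeasurable[𝒢 i] (fun ω => Ψ (hist i ω)) := by
  have := Fintype.toEncodable A
  exact stronglyMeasurable_comp_of_fibers (hT.meas i) Ψ

omit [Fintype A] in
-- The Markov property: `S` contains or misses the fibre of `h` up to a null set, so the transition
-- weights persist inside every event of `𝒢 i`.
theorem measureReal_inter [IsFiniteMeasure P] (hT : IsTreeProcess P 𝒢 κ hist) (i : ℕ) (b : A)
    (h : List A) {S : Set Ω} (hS : MeasurableSet[𝒢 i] S) :
    P.real (S ∩ hist (i + 1) ⁻¹' {b :: h}) = κ h b * P.real (S ∩ hist i ⁻¹' {h}) := by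
  have hsub : hist (i + 1) ⁻¹' {b :: h} ⊆ hist i ⁻¹' {h} := by
    intro ω hω
    obtain ⟨b', hb'⟩ := hT.cons i ω
    simp only [Set.mem_preimage, Set.mem_singleton_iff, hb', List.cons.injEq] at hω ⊢
    exact hω.2
  rcases hT.atom i S h hS with h0 | h0
  · have h1 : P (S ∩ hist (i + 1) ⁻¹' {b :: h}) = 0 :=
      measure_mono_null (Set.inter_subset_inter_right _ hsub) h0
    simp [measureReal_def, h0, h1]
  · have h1 : P (hist (i + 1) ⁻¹' {b :: h} \ S) = 0 :=
      measure_mono_null (Set.sdiff_subset_sdiff_left hsub) h0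
    have h2 : P (S ∩ hist i ⁻¹' {h}) = P (hist i ⁻¹' {h}) := by
      rw [Set.inter_comm]; exact measure_inter_conull' h0
    have h3 : P (S ∩ hist (i + 1) ⁻¹' {b :: h}) = P (hist (i + 1) ⁻¹' {b :: h}) := by
      rw [Set.inter_comm]; exact measure_inter_conull' h1
    have := hT.prob i b h
    simp only [measureReal_def] at this ⊢
    rw [h2, h3, this]

variable [CompleteSpace X]

theorem condExp_succ [IsFiniteMeasure P] (hT : IsTreeProcess P 𝒢 κ hist) (i : ℕ)
    (Ψ : List A → X) :
    P[fun ω => Ψ (hist (i + 1) ω) | 𝒢 i] =ᵐ[P] fun ω => stepMean κ Ψ (hist i ω) := by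
  symm
  refine ae_eq_condExp_of_forall_setIntegral_eq (𝒢.le i) (hT.integrable _ Ψ)
    (fun s _ _ => (hT.integrable i _).integrableOn) ?_
    (hT.stronglyMeasurable i _).aestronglyMeasurable
  intro S hS _
  rw [setIntegral_comp_of_mem_finset (hT.meas' i) _ (hT.mem_hist i),
    setIntegral_comp_of_mem_finset (hT.meas' (i + 1)) _ (hT.mem_hist (i + 1)),
    sum_histories_succ]
  refine Finset.sum_congr rfl fun h _ => ?_
  rw [stepMean, Finset.smul_sum]
  refine Finset.sum_congr rfl fun b _ => ?_
  rw [hT.measureReal_inter i b h hS, smul_smul, mul_comm]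

theorem condExp_add [IsFiniteMeasure P] (hT : IsTreeProcess P 𝒢 κ hist) (i j : ℕ)
    (Ψ : List A → X) :
    P[fun ω => Ψ (hist (i + j) ω) | 𝒢 i] =ᵐ[P] fun ω => (stepMean κ)^[j] Ψ (hist i ω) := by
  induction j generalizing Ψ with
  | zero =>
    simp only [add_zero, Function.iterate_zero, id]
    rw [condExp_of_stronglyMeasurable (𝒢.le i) (hT.stronglyMeasurable i Ψ) (hT.integrable i Ψ)]
  | succ j ih =>
    have h1 : P[P[fun ω => Ψ (hist (i + j + 1) ω) | 𝒢 (i + j)] | 𝒢 i] =ᵐ[P]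
        P[fun ω => Ψ (hist (i + j + 1) ω) | 𝒢 i] :=
      condExp_condExp_of_le (𝒢.mono (by omega)) (𝒢.le _)
    have h2 := condExp_congr_ae (m := 𝒢 i) (hT.condExp_succ (i + j) Ψ)
    rw [← add_assoc, Function.iterate_succ, Function.comp_apply]
    exact h1.symm.trans (h2.trans (ih (stepMean κ Ψ)))

theorem condExp_treeMart [IsFiniteMeasure P] (hT : IsTreeProcess P 𝒢 κ hist) {i N : ℕ}
    (hi : i ≤ N) (F : List A → X) :
    P[fun ω => F (hist N ω) | 𝒢 i] =ᵐ[P] fun ω => treeMart κ N F (hist i ω) := by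
  have := hT.condExp_add i (N - i) F
  rw [Nat.add_sub_cancel' hi] at this
  simpa only [treeMart, hT.length_eq] using this

theorem integral_eq [IsProbabilityMeasure P] (hT : IsTreeProcess P 𝒢 κ hist) (N : ℕ)
    (F : List A → X) : ∫ ω, F (hist N ω) ∂P = (stepMean κ)^[N] F [] := by
  have := hT.condExp_treeMart (Nat.zero_le N) F
  rw [← integral_condExp (𝒢.le 0), integral_congr_ae this]
  simp [hT.zero, treeMart]

omit [NormedSpace ℝ X] [CompleteSpace X] in
theorem eLpNorm_eq [IsProbabilityMeasure P] (hT : IsTreeProcess P 𝒢 κ hist) (N : ℕ)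
    (F : List A → X) : eLpNorm (fun ω => F (hist N ω)) 2 P =
      ENNReal.ofReal (Real.sqrt ((stepMean κ)^[N] (fun h => ‖F h‖ ^ 2) [])) := by
  rw [eLpNorm_two_eq_ofReal_sqrt (hT.memLp N F 2), hT.integral_eq N (fun h => ‖F h‖ ^ 2)]

omit [CompleteSpace X] [Fintype A] in
theorem treeTransform_hist (hT : IsTreeProcess P 𝒢 κ hist) (ε : ℕ → ℝ) (M : List A → X) (N : ℕ)
    (ω : Ω) : treeTransform ε M (hist N ω) =
      ∑ i ∈ Finset.range N, ε i • (M (hist (i + 1) ω) - M (hist i ω)) := by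
  induction N with
  | zero => simp [hT.zero, treeTransform]
  | succ N ih =>
    have hl := hT.length_eq N ω
    obtain ⟨b, hb⟩ := hT.cons N ω
    rw [Finset.sum_range_succ, ← ih, hb, treeTransform, hl]

end IsTreeProcess

end Tree

end WalshUMD

namespace WalshUMD

/-! ### From uniform transition weights to arbitrary ones. -/

section TreeKernels

variable {A B : Type*} [Fintype A] [Fintype B] {X : Type*} [NormedAddCommGroup X]
  [NormedSpace ℝ X]

/-- The image of a tree of histories under a rule `s` selecting the next entry of the new history
from the new history so far and the next entry of the old one. -/
def mapHistory (s : List A → B → A) : List B → List A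
  | [] => []
  | x :: l => s (mapHistory s l) x :: mapHistory s l

omit [Fintype A] [Fintype B] in
theorem length_mapHistory (s : List A → B → A) (l : List B) :
    (mapHistory s l).length = l.length := by
  induction l with
  | nil => rfl
  | cons x l ih => simp [mapHistory, ih]

/-- The transition weights obtained by pushing the uniform distribution on `B` forward under
the selection rule `s`. -/
noncomputable def imageKernel (s : List A → B → A) (h : List A) (a : A) : ℝ :=
  by classical exact ((Finset.univ.filter fun x => s h x = a).card : ℝ) / Fintype.card B

/-- The uniform transition weights on `B`. -/
noncomputable def uniformKernel (B : Type*) [Fintype B] : List B → B → ℝ :=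
  fun _ _ => 1 / Fintype.card B

/-- Grouping the entries of `B` by their image under `s` shows that pullback along `mapHistory`
intertwines the two mean operators. -/
theorem stepMean_uniformKernel_comp (s : List A → B → A) (Ψ : List A → X) (l : List B) :
    stepMean (uniformKernel B) (fun l => Ψ (mapHistory s l)) l =
      stepMean (imageKernel s) Ψ (mapHistory s l) := by
  classical
  simp only [stepMean, uniformKernel, imageKernel, mapHistory]
  rw [← Finset.sum_fiberwise Finset.univ (s (mapHistory s l))]
  refine Finset.sum_congr rfl fun a _ => ?_
  rw [Finset.sum_congr rfl (g := fun _ => (1 / (Fintype.card B : ℝ)) • Ψ (a :: mapHistory s l))]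
  · rw [Finset.sum_const, ← Nat.cast_smul_eq_nsmul ℝ, smul_smul, mul_one_div]
  · intro x hx
    rw [(Finset.mem_filter.1 hx).2]

theorem stepMean_uniformKernel_iterate_comp (s : List A → B → A) (n : ℕ) (Ψ : List A → X)
    (l : List B) :
    (stepMean (uniformKernel B))^[n] (fun l => Ψ (mapHistory s l)) l =
      (stepMean (imageKernel s))^[n] Ψ (mapHistory s l) := by
  induction n generalizing Ψ with
  | zero => rfl
  | succ n ih =>
    rw [Function.iterate_succ, Function.iterate_succ, Function.comp_apply, Function.comp_apply,
      ← ih]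
    exact congrArg (fun Φ => (stepMean (uniformKernel B))^[n] Φ l)
      (funext (stepMean_uniformKernel_comp s Ψ))

theorem treeMart_uniformKernel_comp (s : List A → B → A) (N : ℕ) (F : List A → X)
    (l : List B) :
    treeMart (uniformKernel B) N (fun l => F (mapHistory s l)) l =
      treeMart (imageKernel s) N F (mapHistory s l) := by
  rw [treeMart, stepMean_uniformKernel_iterate_comp, treeMart, length_mapHistory]

/-- Martingale, transform and means for `F` all pull back along `mapHistory` to those of the
composite function, so the inequality for `F` is an instance of the uniform one. -/
theorem TreeBound.imageKernel {c : ℝ} (hc : TreeBound X c (uniformKernel B))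
    (s : List A → B → A) : TreeBound X c (imageKernel s) := by
  intro N F ε hε
  have key : ∀ l, treeTransform ε (treeMart (uniformKernel B) N (fun l => F (mapHistory s l))) l =
      treeTransform ε (treeMart (WalshUMD.imageKernel s) N F) (mapHistory s l) := by
    intro l
    induction l with
    | nil => rfl
    | cons x l ih =>
      rw [treeTransform, ih, treeMart_uniformKernel_comp, treeMart_uniformKernel_comp]
      simp only [mapHistory, treeTransform, length_mapHistory]
  have := hc N (fun l => F (mapHistory s l)) ε hε
  simp only [key, treeMart_uniformKernel_comp, mapHistory] at this
  rwa [stepMean_uniformKernel_iterate_comp s N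
      (fun h => ‖treeTransform ε (treeMart (WalshUMD.imageKernel s) N F) h‖ ^ 2),
    stepMean_uniformKernel_iterate_comp s N
      (fun h => ‖F h - treeMart (WalshUMD.imageKernel s) N F []‖ ^ 2)] at this

theorem exists_card_fiber_eq [DecidableEq A] {n : ℕ} (k : A → ℕ) (hk : ∑ a, k a = n) :
    ∃ s : Fin n → A, ∀ a, (Finset.univ.filter fun x => s x = a).card = k a := by
  have hcard : Fintype.card (Fin n) = Fintype.card (Σ a, Fin (k a)) := by simp [hk]
  refine ⟨fun x => (Fintype.equivOfCardEq hcard x).1, fun a => ?_⟩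
  rw [← Fintype.card_subtype, ← Fintype.card_fin (k a)]
  refine Fintype.card_congr (((Fintype.equivOfCardEq hcard).subtypeEquiv (q := fun y => y.1 = a)
    fun _ => Iff.rfl).trans (Equiv.sigmaSubtype a))

/-- Every probability vector is a limit of images of uniform distributions on `2^m` points. -/
theorem exists_tendsto_card_fiber [DecidableEq A] (p : A → ℝ) (hp : ∀ a, 0 ≤ p a)
    (hp1 : ∑ a, p a = 1) :
    ∃ s : (m : ℕ) → Fin (2 ^ m) → A, ∀ a, Tendsto (fun m =>
      ((Finset.univ.filter fun x => s m x = a).card : ℝ) / (2 : ℝ) ^ m) atTop (𝓝 (p a)) := by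
  have hne : Nonempty A := by
    by_contra h
    rw [not_nonempty_iff] at h
    simp at hp1
  obtain ⟨a₀⟩ := hne
  let k : ℕ → A → ℕ := fun m a => ⌊p a * 2 ^ m⌋₊
  have hk : ∀ m, ∑ a ∈ Finset.univ.erase a₀, k m a ≤ 2 ^ m := by
    intro m
    have : (∑ a ∈ Finset.univ.erase a₀, (k m a : ℝ)) ≤ 2 ^ m := by
      calc _ ≤ ∑ a ∈ Finset.univ.erase a₀, p a * 2 ^ m :=
            Finset.sum_le_sum fun a _ => Nat.floor_le (mul_nonneg (hp a) (by positivity))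
        _ ≤ ∑ a, p a * 2 ^ m :=
            Finset.sum_le_sum_of_subset_of_nonneg (Finset.erase_subset _ _)
              fun a _ _ => mul_nonneg (hp a) (by positivity)
        _ = 2 ^ m := by rw [← Finset.sum_mul, hp1, one_mul]
    exact_mod_cast this
  have hlim : ∀ a, Tendsto (fun m => (k m a : ℝ) / (2 : ℝ) ^ m) atTop (𝓝 (p a)) := fun a =>
    (tendsto_nat_floor_mul_div_atTop (hp a)).comp (tendsto_pow_atTop_atTop_of_one_lt one_lt_two)
  -- All weights are rounded down except that of `a₀`, which takes the remaining points so that the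
  -- counts add up to 2^m.
  let k' : ℕ → A → ℕ := fun m a =>
    if a = a₀ then 2 ^ m - ∑ a ∈ Finset.univ.erase a₀, k m a else k m a
  have hk' : ∀ m, ∑ a, k' m a = 2 ^ m := by
    intro m
    rw [← Finset.add_sum_erase _ _ (Finset.mem_univ a₀)]
    rw [Finset.sum_congr rfl (g := k m)]
    · simp only [k', if_true]
      exact Nat.sub_add_cancel (hk m)
    · intro a ha
      simp [k', Finset.ne_of_mem_erase ha]
  choose s hs using fun m => exists_card_fiber_eq (k' m) (hk' m)
  refine ⟨s, fun a => ?_⟩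
  simp only [hs]
  by_cases ha : a = a₀
  · subst ha
    have h1 : Tendsto (fun m => 1 - ∑ b ∈ Finset.univ.erase a, (k m b : ℝ) / (2 : ℝ) ^ m) atTop
        (𝓝 (1 - ∑ b ∈ Finset.univ.erase a, p b)) :=
      tendsto_const_nhds.sub (tendsto_finsetSum _ fun b _ => hlim b)
    have h2 : 1 - ∑ b ∈ Finset.univ.erase a, p b = p a := by
      rw [← hp1, ← Finset.add_sum_erase _ _ (Finset.mem_univ a)]; ring
    rw [h2] at h1
    refine h1.congr fun m => ?_
    simp only [k', if_true]
    rw [Nat.cast_sub (hk m)]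
    push_cast
    rw [sub_div, div_self (by positivity), Finset.sum_div]
  · simpa [k', ha] using hlim a

/-- Finitely many sums and products are involved. `Ψ` varies with the parameter because the tree
martingale itself depends on the weights. -/
theorem continuous_stepMean_iterate {T : Type*} [TopologicalSpace T] {κ : T → List A → A → ℝ}
    (hκ : ∀ h a, Continuous fun t => κ t h a) (n : ℕ) {Ψ : T → List A → X}
    (hΨ : ∀ h, Continuous fun t => Ψ t h) (h : List A) :
    Continuous fun t => (stepMean (κ t))^[n] (Ψ t) h := by
  induction n generalizing h with
  | zero => exact hΨ h
  | succ n ih =>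
    simp only [Function.iterate_succ', Function.comp_apply, stepMean]
    exact continuous_finsetSum _ fun b _ => (hκ h b).smul (ih _)

omit [Fintype A] in
theorem continuous_treeTransform {T : Type*} [TopologicalSpace T] (ε : ℕ → ℝ)
    {M : T → List A → X} (hM : ∀ h, Continuous fun t => M t h) (h : List A) :
    Continuous fun t => treeTransform ε (M t) h := by
  induction h with
  | nil => exact continuous_const
  | cons b h ih =>
    simp only [treeTransform]
    exact ih.add (((hM _).sub (hM _)).const_smul _)

/-- The tree inequality passes to limits of transition weights. -/
theorem TreeBound.of_tendsto {c : ℝ} {κ : List A → A → ℝ} {κs : ℕ → List A → A → ℝ}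
    (hκ : ∀ h a, Tendsto (fun m => κs m h a) atTop (𝓝 (κ h a)))
    (hb : ∀ m, TreeBound X c (κs m)) : TreeBound X c κ := by
  intro N F ε hε
  have hlim : Tendsto κs atTop (𝓝 κ) :=
    tendsto_pi_nhds.2 fun h => tendsto_pi_nhds.2 fun a => hκ h a
  have hid : ∀ (h : List A) (a : A), Continuous fun κ : List A → A → ℝ => κ h a :=
    fun h a => (continuous_apply a).comp (continuous_apply h)
  have hmart : ∀ h, Continuous fun κ : List A → A → ℝ => treeMart κ N F h := fun h =>
    continuous_stepMean_iterate hid (N - h.length) (Ψ := fun _ => F)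
      (fun _ => continuous_const) h
  have h1 := (continuous_stepMean_iterate hid N
    (fun h => (continuous_treeTransform ε hmart h).norm.pow 2) []).tendsto κ
  have h2 := (continuous_stepMean_iterate hid N (Ψ := fun κ h => ‖F h - treeMart κ N F []‖ ^ 2)
    (fun h => (continuous_const.sub (hmart [])).norm.pow 2) []).tendsto κ
  exact le_of_tendsto_of_tendsto' (h1.comp hlim) ((h2.comp hlim).const_mul _)
    fun m => hb m N F ε hε

/-- The tree inequality for the uniform distributions on `2^m` points implies the one for
arbitrary transition probabilities. -/
theorem TreeBound.of_uniformKernel {c : ℝ}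
    (hc : ∀ m : ℕ, TreeBound X c (uniformKernel (Fin (2 ^ m))))
    {κ : List A → A → ℝ} (hκ : ∀ h a, 0 ≤ κ h a) (hκ1 : ∀ h, ∑ a, κ h a = 1) :
    TreeBound X c κ := by
  classical
  choose s hs using fun h => exists_tendsto_card_fiber (κ h) (hκ h) (hκ1 h)
  refine TreeBound.of_tendsto (κs := fun m => WalshUMD.imageKernel (fun h => s h m)) ?_
    fun m => (hc m).imageKernel _
  intro h a
  refine (hs h a).congr fun m => ?_
  simp [WalshUMD.imageKernel]

end TreeKernels

end WalshUMD

namespace WalshUMD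

/-! ### From finite trees to arbitrary martingales. -/

section General

variable {A : Type*} [Fintype A] {X : Type*} [NormedAddCommGroup X]
  [NormedSpace ℝ X] {Ω : Type*} {mΩ : MeasurableSpace Ω} {P : Measure Ω}

/-- The tree inequality expressed by a process realizing the transition weights. -/
theorem IsTreeProcess.eLpNorm_transform_le_iff [IsProbabilityMeasure P]
    {𝒢 : Filtration ℕ mΩ} {κ : List A → A → ℝ} {hist : ℕ → Ω → List A}
    (hT : IsTreeProcess P 𝒢 κ hist) {c : ℝ} (hc : 0 ≤ c) (N : ℕ) (F : List A → X) (ε : ℕ → ℝ) :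
    eLpNorm (fun ω => ∑ i ∈ Finset.range N, ε i •
        (treeMart κ N F (hist (i + 1) ω) - treeMart κ N F (hist i ω))) 2 P ≤
      ENNReal.ofReal c * eLpNorm (fun ω => F (hist N ω) - treeMart κ N F []) 2 P ↔
    (stepMean κ)^[N] (fun h => ‖treeTransform ε (treeMart κ N F) h‖ ^ 2) [] ≤
      c ^ 2 * (stepMean κ)^[N] (fun h => ‖F h - treeMart κ N F []‖ ^ 2) [] := by
  simp only [← hT.treeTransform_hist]
  rw [hT.eLpNorm_eq N (treeTransform ε (treeMart κ N F)),
    hT.eLpNorm_eq N (fun h => F h - treeMart κ N F []), ← ENNReal.ofReal_mul hc]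
  have hb : 0 ≤ (stepMean κ)^[N] (fun h => ‖F h - treeMart κ N F []‖ ^ 2) [] := by
    rw [← hT.integral_eq]; positivity
  rw [ENNReal.ofReal_le_ofReal_iff (by positivity),
    Real.sqrt_le_left (by positivity), mul_pow, Real.sq_sqrt hb]

/-- The history of the first `i` entries of a sequence, newest first. -/
def historyOf {A : Type*} (φ : ℕ → Ω → A) : ℕ → Ω → List A
  | 0, _ => []
  | i + 1, ω => φ i ω :: historyOf φ i ω

theorem length_historyOf {A : Type*} (φ : ℕ → Ω → A) (i : ℕ) (ω : Ω) :
    (historyOf φ i ω).length = i := by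
  induction i with
  | zero => rfl
  | succ i ih => simp [historyOf, ih]

theorem measurableSet_historyOf {A : Type*} {ℱ : Filtration ℕ mΩ} {φ : ℕ → Ω → A}
    (hφ : ∀ i a, MeasurableSet[ℱ (i + 1)] (φ i ⁻¹' {a})) (i : ℕ) (h : List A) :
    MeasurableSet[ℱ i] (historyOf φ i ⁻¹' {h}) := by
  induction i generalizing h with
  | zero =>
    cases h with
    | nil =>
      have : historyOf φ 0 ⁻¹' {[]} = Set.univ := by ext; simp [historyOf]
      rw [this]
      exact @MeasurableSet.univ _ (ℱ 0)
    | cons b h =>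
      have : historyOf φ 0 ⁻¹' {b :: h} = ∅ := by ext; simp [historyOf]
      rw [this]
      exact @MeasurableSet.empty _ (ℱ 0)
  | succ i ih =>
    cases h with
    | nil =>
      have : historyOf φ (i + 1) ⁻¹' {[]} = ∅ := by ext; simp [historyOf]
      rw [this]
      exact @MeasurableSet.empty _ (ℱ (i + 1))
    | cons b h =>
      have : historyOf φ (i + 1) ⁻¹' {b :: h} = φ i ⁻¹' {b} ∩ historyOf φ i ⁻¹' {h} := by
        ext; simp [historyOf]
      rw [this]
      exact @MeasurableSet.inter _ (ℱ (i + 1)) _ _ (hφ i b) (ℱ.mono (Nat.le_succ i) _ (ih h))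

/-- The filtration generated by the histories of a sequence. -/
def historyFiltration {A : Type*} [Fintype A] (ℱ : Filtration ℕ mΩ) (φ : ℕ → Ω → A)
    (hφ : ∀ i a, MeasurableSet[ℱ (i + 1)] (φ i ⁻¹' {a})) : Filtration ℕ mΩ where
  seq i := MeasurableSpace.comap (historyOf φ i) ⊤
  mono' := by
    refine monotone_nat_of_le_succ fun i => ?_
    rintro _ ⟨T, -, rfl⟩
    refine ⟨List.tail ⁻¹' T, trivial, ?_⟩
    ext ω; simp [historyOf]
  le' i := by
    have := Fintype.toEncodable A
    exact comap_top_le_of_fibers fun h => ℱ.le i _ (measurableSet_historyOf hφ i h)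

theorem historyFiltration_le (ℱ : Filtration ℕ mΩ) (φ : ℕ → Ω → A)
    (hφ : ∀ i a, MeasurableSet[ℱ (i + 1)] (φ i ⁻¹' {a})) (i : ℕ) :
    historyFiltration ℱ φ hφ i ≤ ℱ i := by
  have := Fintype.toEncodable A
  exact comap_top_le_of_fibers fun h => measurableSet_historyOf hφ i h

/-- The conditional probabilities of the next entry of a sequence given its history. -/
noncomputable def historyKernel (P : Measure Ω) (φ : ℕ → Ω → A) (h : List A) (b : A) : ℝ :=
  -- On null histories any probability vector would do; the uniform one keeps the total weight equal
  -- to 1.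
  if P.real (historyOf φ h.length ⁻¹' {h}) = 0 then 1 / Fintype.card A
  else P.real (historyOf φ (h.length + 1) ⁻¹' {b :: h}) / P.real (historyOf φ h.length ⁻¹' {h})

theorem historyKernel_nonneg (φ : ℕ → Ω → A) (h : List A) (b : A) :
    0 ≤ historyKernel P φ h b := by
  unfold historyKernel; split_ifs <;> positivity

theorem sum_historyKernel [IsProbabilityMeasure P] (ℱ : Filtration ℕ mΩ) (φ : ℕ → Ω → A)
    (hφ : ∀ i a, MeasurableSet[ℱ (i + 1)] (φ i ⁻¹' {a})) (h : List A) :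
    ∑ b, historyKernel P φ h b = 1 := by
  have hne : Nonempty A := (nonempty_of_isProbabilityMeasure P).map (φ 0)
  unfold historyKernel
  split_ifs with h0
  · simp
  · rw [← Finset.sum_div, div_eq_one_iff_eq h0, ← measureReal_biUnion_finset]
    · congr 1
      ext ω; simp [historyOf]
    · intro a _ b _ hab
      refine Disjoint.preimage _ ?_
      simpa using hab
    · intro b _
      exact ℱ.le _ _ (measurableSet_historyOf hφ _ _)

theorem isTreeProcess_historyOf [IsFiniteMeasure P] (ℱ : Filtration ℕ mΩ) (φ : ℕ → Ω → A)
    (hφ : ∀ i a, MeasurableSet[ℱ (i + 1)] (φ i ⁻¹' {a})) :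
    IsTreeProcess P (historyFiltration ℱ φ hφ) (historyKernel P φ) (historyOf φ) where
  zero _ := rfl
  cons i ω := ⟨φ i ω, rfl⟩
  meas i h := ⟨{h}, trivial, rfl⟩
  atom i S h hS := by
    obtain ⟨T, -, rfl⟩ := hS
    by_cases hT : h ∈ T
    · right
      convert measure_empty (μ := P)
      ext ω; simp; rintro rfl; exact hT
    · left
      convert measure_empty (μ := P)
      ext ω; simp; rintro h' rfl; exact hT h'
  prob i b h := by
    by_cases hl : h.length = i
    · subst hl
      unfold historyKernel
      split_ifs with h0
      · rw [h0, mul_zero]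
        have hsub : historyOf φ (h.length + 1) ⁻¹' {b :: h} ⊆ historyOf φ h.length ⁻¹' {h} := by
          intro ω; simp [historyOf]
        exact le_antisymm ((measureReal_mono hsub).trans h0.le) measureReal_nonneg
      · rw [div_mul_cancel₀ _ h0]
    · have h1 : historyOf φ (i + 1) ⁻¹' {b :: h} = ∅ := by
        ext ω; simp [historyOf]; rintro - rfl; exact hl (length_historyOf φ i ω)
      have h2 : historyOf φ i ⁻¹' {h} = ∅ := by
        ext ω; simp; rintro rfl; exact hl (length_historyOf φ i ω)
      simp [h1, h2]

variable [CompleteSpace X]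

/-- The tree inequality bounds the transforms of martingales generated by a finitely valued
sequence. -/
theorem eLpNorm_transform_condExp_history_le [IsProbabilityMeasure P] (ℱ : Filtration ℕ mΩ)
    (φ : ℕ → Ω → A) (hφ : ∀ i a, MeasurableSet[ℱ (i + 1)] (φ i ⁻¹' {a})) {c : ℝ} (hc : 0 ≤ c)
    (hb : TreeBound X c (historyKernel P φ)) (f : Ω → X) (K : ℕ) (ε : ℕ → ℝ)
    (hε : ∀ i, ε i = 1 ∨ ε i = -1) :
    eLpNorm (fun ω => ∑ i ∈ Finset.range K, ε i •
        ((P[f | historyFiltration ℱ φ hφ (i + 1)]) ω - (P[f | historyFiltration ℱ φ hφ i]) ω))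
        2 P ≤
      ENNReal.ofReal c * eLpNorm (fun ω => (P[f | historyFiltration ℱ φ hφ K]) ω -
        (P[f | historyFiltration ℱ φ hφ 0]) ω) 2 P := by
  have hT := isTreeProcess_historyOf (P := P) ℱ φ hφ
  set 𝒢 := historyFiltration ℱ φ hφ with h𝒢
  let _ : MeasurableSpace (List A) := ⊤
  -- A function measurable for the σ-algebra generated by the history factors through the history.
  obtain ⟨F, -, hF⟩ := StronglyMeasurable.exists_eq_measurable_comp (f := historyOf φ K)
    (g := P[f | 𝒢 K]) stronglyMeasurable_condExp
  have hi : ∀ i ≤ K, P[f | 𝒢 i] =ᵐ[P] fun ω =>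
      treeMart (historyKernel P φ) K F (historyOf φ i ω) := by
    intro i hi
    have h1 : P[P[f | 𝒢 K] | 𝒢 i] =ᵐ[P] P[f | 𝒢 i] :=
      condExp_condExp_of_le (𝒢.mono hi) (𝒢.le K)
    rw [hF] at h1
    exact h1.symm.trans (hT.condExp_treeMart hi F)
  have key := (hT.eLpNorm_transform_le_iff hc K F ε).2 (hb K F ε hε)
  refine le_trans (le_of_eq ?_) (key.trans (le_of_eq ?_))
  · refine eLpNorm_congr_ae ?_
    have : ∀ᵐ ω ∂P, ∀ i ≤ K, (P[f | 𝒢 i]) ω =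
        treeMart (historyKernel P φ) K F (historyOf φ i ω) := by
      rw [ae_all_iff]; intro i
      rw [ae_all_iff]; exact hi i
    filter_upwards [this] with ω hω
    refine Finset.sum_congr rfl fun i hi => ?_
    have := Finset.mem_range.1 hi
    rw [hω i (by omega), hω (i + 1) (by omega)]
  · congr 1
    refine eLpNorm_congr_ae ?_
    filter_upwards [hi 0 (Nat.zero_le K)] with ω h0
    rw [h0, hF]
    rfl

omit [NormedSpace ℝ X] [CompleteSpace X] in
-- Simple functions are dense in L₂ of the trimmed measure; trimming is what keeps the approximant
-- `m`-measurable.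
theorem exists_finite_range_eLpNorm_sub_le {m : MeasurableSpace Ω} (hm : m ≤ mΩ) {f : Ω → X}
    (hfm : StronglyMeasurable[m] f) (hf : MemLp f 2 P) {δ : ℝ≥0∞} (hδ : δ ≠ 0) :
    ∃ s : Ω → X, (Set.range s).Finite ∧ (∀ x, MeasurableSet[m] (s ⁻¹' {x})) ∧
      StronglyMeasurable[m] s ∧ eLpNorm (fun ω => f ω - s ω) 2 P ≤ δ := by
  have hmem : MemLp f 2 (P.trim hm) := by
    refine ⟨hfm.aestronglyMeasurable, ?_⟩
    rw [eLpNorm_trim _ hfm]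
    exact hf.2
  obtain ⟨s, hs, -⟩ := @MemLp.exists_simpleFunc_eLpNorm_sub_lt Ω m 2 X _ f (P.trim hm) hmem
    (by norm_num) δ hδ
  have hsm : StronglyMeasurable[m] s := @SimpleFunc.stronglyMeasurable _ _ m _ s
  rw [eLpNorm_trim hm (hfm.sub hsm)] at hs
  exact ⟨s, @SimpleFunc.finite_range _ _ m s, @SimpleFunc.measurableSet_fiber _ _ m s, hsm, hs.le⟩

/-- The tree inequality bounds the transforms of square integrable martingales starting at `0`. -/
theorem eLpNorm_transform_le_of_treeBound {X : Type u} [NormedAddCommGroup X] [NormedSpace ℝ X]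
    [CompleteSpace X] [IsProbabilityMeasure P] {ℱ : Filtration ℕ mΩ}
    {c : ℝ} (hc : 0 ≤ c)
    (hb : ∀ (A : Type u) [Fintype A] (κ : List A → A → ℝ), (∀ h a, 0 ≤ κ h a) →
      (∀ h, ∑ a, κ h a = 1) → TreeBound X c κ)
    {M : ℕ → Ω → X} (hM : Martingale M ℱ P) (hM0 : M 0 = 0) {K : ℕ} (hK : MemLp (M K) 2 P)
    (ε : ℕ → ℝ) (hε : ∀ i, ε i = 1 ∨ ε i = -1) :
    eLpNorm (fun ω => ∑ i ∈ Finset.range K, ε i • (M (i + 1) ω - M i ω)) 2 P ≤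
      ENNReal.ofReal c * eLpNorm (M K) 2 P := by
  classical
  -- Conditional expectation contracts L₂, so integrability at time `K` passes to earlier times.
  have hMi : ∀ i ≤ K, MemLp (M i) 2 P := fun i hi =>
    (hK.condExp (m := ℱ i) one_le_two).ae_eq (hM.condExp_ae_eq hi)
  refine ENNReal.le_of_forall_pos_le_add fun η hη _ => ?_
  -- Each of the `K` differences will contribute two errors of size at most 2δ.
  obtain ⟨δ, hδ0, hδ⟩ : ∃ δ : ℝ≥0, 0 < δ ∧ 4 * K * δ ≤ η := by
    refine ⟨η / (4 * K + 1), by positivity, ?_⟩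
    rw [mul_div_assoc', div_le_iff₀ (by positivity)]
    nlinarith [hη.le]
  have happ : ∀ i, ∃ s : Ω → X, (Set.range s).Finite ∧
      (∀ x, MeasurableSet[ℱ (i + 1)] (s ⁻¹' {x})) ∧
      (i < K → eLpNorm (fun ω => M (i + 1) ω - s ω) 2 P ≤ δ) := by
    intro i
    by_cases hi : i < K
    · obtain ⟨s, h1, h2, -, h3⟩ := exists_finite_range_eLpNorm_sub_le (ℱ.le (i + 1))
        (hM.stronglyMeasurable (i + 1)) (hMi (i + 1) hi) (ENNReal.coe_ne_zero.2 hδ0.ne')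
      exact ⟨s, h1, h2, fun _ => h3⟩
    · exact ⟨fun _ => 0, Set.finite_range_const,
        fun x => @MeasurableSet.const _ (ℱ (i + 1)) ((0 : X) = x),
        fun h => absurd h hi⟩
  choose s hsf hsφ hs using happ
  -- A common finite alphabet inside `X`, hence in its universe; 0 serves as the constant entry from
  -- time `K` on.
  let D : Finset X := insert 0 ((Finset.range K).biUnion fun i => (hsf i).toFinset)
  have hD : ∀ i ω, i < K → s i ω ∈ D := fun i ω hi =>
    Finset.mem_insert_of_mem (Finset.mem_biUnion.2 ⟨i, Finset.mem_range.2 hi, by simp⟩)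
  let φ : ℕ → Ω → D := fun i ω =>
    if hi : i < K then ⟨s i ω, hD i ω hi⟩ else ⟨0, Finset.mem_insert_self _ _⟩
  have hφ : ∀ i a, MeasurableSet[ℱ (i + 1)] (φ i ⁻¹' {a}) := by
    intro i a
    by_cases hi : i < K
    · have : φ i ⁻¹' {a} = s i ⁻¹' {(a : X)} := by
        ext ω; simp [φ, hi, Subtype.ext_iff]
      rw [this]
      exact hsφ i a
    · have : φ i = fun _ => ⟨0, Finset.mem_insert_self _ _⟩ := by
        ext ω; simp [φ, hi]
      rw [this]
      exact @measurable_const _ _ ⊤ (ℱ (i + 1)) _ _ trivial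
  have hT := isTreeProcess_historyOf (P := P) ℱ φ hφ
  have hbound := eLpNorm_transform_condExp_history_le ℱ φ hφ hc
    (hb D (historyKernel P φ) (historyKernel_nonneg φ) (sum_historyKernel ℱ φ hφ)) (M K) K ε hε
  have hle := historyFiltration_le ℱ φ hφ
  set 𝒢 := historyFiltration ℱ φ hφ
  -- Since `𝒢 i` lies in `ℱ i`, the comparison martingale at time `i` is the projection of `M i`
  -- itself.
  have hA : ∀ i ≤ K, P[M K | 𝒢 i] =ᵐ[P] P[M i | 𝒢 i] := fun i hi =>
    (condExp_condExp_of_le (hle i) (ℱ.le i)).symm.trans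
      (condExp_congr_ae (hM.condExp_ae_eq hi))
  have hA0 : P[M K | 𝒢 0] =ᵐ[P] 0 := by
    refine (hA 0 (Nat.zero_le K)).trans ?_
    rw [hM0, condExp_zero]
  let e : ℕ → Ω → X := fun i ω => M i ω - (P[M K | 𝒢 i]) ω
  have hem : ∀ i, i ≤ K → AEStronglyMeasurable (e i) P := fun i hi =>
    (hMi i hi).1.sub (integrable_condExp.1)
  have he : ∀ i ≤ K, eLpNorm (e i) 2 P ≤ 2 * δ := by
    intro i hi
    rcases i with _ | i
    · have : e 0 =ᵐ[P] 0 := by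
        filter_upwards [hA0] with ω hω
        simp [e, hω, hM0]
      rw [eLpNorm_congr_ae this, eLpNorm_zero]
      exact zero_le
    · let u : Ω → X := fun ω => M (i + 1) ω - s i ω
      have hsm : StronglyMeasurable[𝒢 (i + 1)] (fun ω => s i ω) := by
        -- The newest entry of the history at time `i + 1` is `s i`; the default 0 is never reached
        -- there.
        have := hT.stronglyMeasurable (i + 1) (fun l => (l.head?.map (Subtype.val)).getD 0)
        convert this using 1
        ext ω
        simp [historyOf, φ, Nat.lt_of_succ_le hi]
      have hs2 : AEStronglyMeasurable (fun ω => s i ω) P :=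
        (hsm.mono (𝒢.le _)).aestronglyMeasurable
      have hu : MemLp u 2 P := ⟨(hMi _ hi).1.sub hs2,
        (hs i (Nat.lt_of_succ_le hi)).trans_lt ENNReal.coe_lt_top⟩
      have hs_int : Integrable (fun ω => s i ω) P := by
        have := (hM.integrable (i + 1)).sub (hu.integrable one_le_two)
        refine this.congr (Eventually.of_forall fun ω => ?_)
        simp [u]
      -- The approximant `s i` is fixed by the projection, so only the part `u` of norm at most δ
      -- contributes, once directly and once projected.
      have h1 : e (i + 1) =ᵐ[P] u - P[u | 𝒢 (i + 1)] := by
        have h2 : P[u | 𝒢 (i + 1)] =ᵐ[P] P[M (i + 1) | 𝒢 (i + 1)] - P[fun ω => s i ω | 𝒢 (i + 1)] :=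
          condExp_sub (hM.integrable (i + 1)) hs_int _
        rw [condExp_of_stronglyMeasurable (𝒢.le _) hsm hs_int] at h2
        filter_upwards [h2, hA (i + 1) hi] with ω h2 h3
        simp only [e, u, Pi.sub_apply, h3] at h2 ⊢
        rw [h2]; abel
      rw [eLpNorm_congr_ae h1, two_mul]
      refine (eLpNorm_sub_le hu.1 integrable_condExp.1 one_le_two).trans ?_
      exact add_le_add (hs i (Nat.lt_of_succ_le hi))
        ((eLpNorm_condExp_le_eLpNorm u one_le_two).trans (hs i (Nat.lt_of_succ_le hi)))
  have hsplit : (fun ω => ∑ i ∈ Finset.range K, ε i • (M (i + 1) ω - M i ω)) =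
      (fun ω => ∑ i ∈ Finset.range K, ε i • ((P[M K | 𝒢 (i + 1)]) ω - (P[M K | 𝒢 i]) ω)) +
        ∑ i ∈ Finset.range K, ε i • (e (i + 1) - e i) := by
    ext ω
    simp only [Pi.add_apply, Finset.sum_apply, Pi.smul_apply, Pi.sub_apply,
      ← Finset.sum_add_distrib, ← smul_add, e]
    refine Finset.sum_congr rfl fun i _ => ?_
    congr 1; abel
  have hmeas1 : AEStronglyMeasurable (fun ω => ∑ i ∈ Finset.range K, ε i •
      ((P[M K | 𝒢 (i + 1)]) ω - (P[M K | 𝒢 i]) ω)) P :=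
    Finset.aestronglyMeasurable_fun_sum _ fun i _ =>
      (integrable_condExp.1.sub integrable_condExp.1).const_smul _
  have hmeas2 : ∀ i ∈ Finset.range K, AEStronglyMeasurable (ε i • (e (i + 1) - e i)) P := by
    intro i hi
    have := Finset.mem_range.1 hi
    exact ((hem _ (by omega)).sub (hem _ (by omega))).const_smul _
  rw [hsplit]
  refine (eLpNorm_add_le hmeas1 (Finset.aestronglyMeasurable_sum _ hmeas2) one_le_two).trans ?_
  gcongr
  · refine hbound.trans ?_
    gcongr
    refine (eLpNorm_congr_ae (g := P[M K | 𝒢 K]) ?_).trans_le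
      (eLpNorm_condExp_le_eLpNorm _ one_le_two)
    filter_upwards [hA0] with ω hω
    simp [hω]
  · refine (eLpNorm_sum_le hmeas2 one_le_two).trans ?_
    calc _ ≤ ∑ i ∈ Finset.range K, (4 * δ : ℝ≥0∞) := by
          refine Finset.sum_le_sum fun i hi => ?_
          have hi' := Finset.mem_range.1 hi
          have h1 : ‖ε i‖ₑ = 1 := by rcases hε i with h | h <;> simp [h]
          rw [eLpNorm_const_smul, h1, one_mul]
          refine (eLpNorm_sub_le (hem _ (by omega)) (hem _ (by omega)) one_le_two).trans ?_
          refine (add_le_add (he _ (by omega)) (he _ (by omega))).trans (le_of_eq ?_)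
          ring
      _ = ((4 * K * δ : ℝ≥0) : ℝ≥0∞) := by
          simp; ring
      _ ≤ η := by exact_mod_cast hδ

/-- The tree inequality for all finite transition probabilities implies the UMD property. -/
theorem hasUMD_of_treeBound {X : Type u} [NormedAddCommGroup X] [NormedSpace ℝ X]
    [CompleteSpace X] {c : ℝ} (hc : 0 ≤ c)
    (hb : ∀ (A : Type u) [Fintype A] (κ : List A → A → ℝ), (∀ h a, 0 ≤ κ h a) →
      (∀ h, ∑ a, κ h a = 1) → TreeBound X c κ) : HasUMD.{u, v} X := by
  -- Adding 1 makes the constant nonzero, so the right side is `⊤` whenever its norm is, even if `c`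
  -- is 0.
  refine ⟨c.toNNReal + 1, ?_⟩
  intro Ω mΩ P _ ℱ M hM ε hε n
  have hsum : ∀ ω, ∑ i ∈ Finset.range (n + 1), (M (i + 1) ω - M i ω) = M (n + 1) ω - M 0 ω :=
    fun ω => Finset.sum_range_sub (fun i => M i ω) (n + 1)
  simp only [hsum]
  let N : ℕ → Ω → X := M - fun _ => M 0
  have hN : Martingale N ℱ P :=
    hM.sub (martingale_const_fun ℱ P (hM.stronglyMeasurable 0) (hM.integrable 0))
  by_cases htop : eLpNorm (fun ω => M (n + 1) ω - M 0 ω) 2 P = ⊤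
  · rw [htop, ENNReal.mul_top (by simp)]
    exact le_top
  · have hK : MemLp (N (n + 1)) 2 P :=
      ⟨(hN.integrable (n + 1)).1, lt_top_iff_ne_top.2 htop⟩
    have := eLpNorm_transform_le_of_treeBound hc hb hN (sub_self _) hK ε hε
    simp only [N, Pi.sub_apply, sub_sub_sub_cancel_right] at this
    exact this.trans (mul_le_mul'
      (ENNReal.coe_le_coe.2 (le_add_of_nonneg_right zero_le_one)) (le_of_eq rfl))

end General

end WalshUMD

namespace WalshUMD

/-! ### Dyadic filtration and Walsh partial sums on the unit interval. -/

section UnitInterval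

instance : IsProbabilityMeasure unitMeasure := ⟨by simp [unitMeasure]⟩

theorem ae_mem_Ico : ∀ᵐ t ∂unitMeasure, t ∈ Set.Ico (0 : ℝ) 1 := by
  rw [unitMeasure, ← Measure.restrict_congr_set Ico_ae_eq_Icc]
  exact ae_restrict_mem measurableSet_Ico

theorem measurable_floor_mul (a : ℝ) : Measurable fun t : ℝ => ⌊a * t⌋ :=
  Int.measurable_floor.comp (measurable_const_mul a)

theorem measurableSet_floor_mul (a : ℝ) (v : ℤ) :
    MeasurableSet ((fun t : ℝ => ⌊a * t⌋) ⁻¹' {v}) :=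
  measurable_floor_mul a (measurableSet_singleton v)

theorem floor_mul_mem_Ico {n : ℕ} (hn : 0 < n) {t : ℝ} (ht : t ∈ Set.Ico (0 : ℝ) 1) :
    ⌊(n : ℝ) * t⌋ ∈ Finset.Ico (0 : ℤ) n := by
  have hn' : (0 : ℝ) < n := by exact_mod_cast hn
  rw [Finset.mem_Ico]
  constructor
  · exact Int.floor_nonneg.2 (mul_nonneg hn'.le ht.1)
  · rw [Int.floor_lt]; push_cast
    nlinarith [ht.2]

theorem unitMeasure_floor_mul {n : ℕ} (hn : 0 < n) {v : ℤ} (hv : v ∈ Finset.Ico (0 : ℤ) n) :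
    unitMeasure.real ((fun t : ℝ => ⌊(n : ℝ) * t⌋) ⁻¹' {v}) = 1 / n := by
  have hn' : (0 : ℝ) < n := by exact_mod_cast hn
  rw [Finset.mem_Ico] at hv
  have hv0 : (0 : ℝ) ≤ v := by exact_mod_cast hv.1
  have hv1 : (v : ℝ) + 1 ≤ n := by exact_mod_cast hv.2
  have hset : (fun t : ℝ => ⌊(n : ℝ) * t⌋) ⁻¹' {v} = Set.Ico (v / n : ℝ) ((v + 1) / n) := by
    ext t
    simp only [Set.mem_preimage, Set.mem_singleton_iff, Int.floor_eq_iff, Set.mem_Ico,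
      div_le_iff₀ hn', lt_div_iff₀ hn', mul_comm t]
  have hsub : Set.Ico (v / n : ℝ) ((v + 1) / n) ⊆ Set.Icc 0 1 := by
    intro t ht
    exact ⟨(div_nonneg hv0 hn'.le).trans ht.1, ht.2.le.trans ((div_le_one hn').2 hv1)⟩
  rw [hset, unitMeasure, measureReal_restrict_apply measurableSet_Ico,
    Set.inter_eq_left.2 hsub, Real.volume_real_Ico_of_le (by gcongr; linarith)]
  ring

theorem unitMeasure_floor_mul_of_notMem {n : ℕ} (hn : 0 < n) {v : ℤ}
    (hv : v ∉ Finset.Ico (0 : ℤ) n) :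
    unitMeasure ((fun t : ℝ => ⌊(n : ℝ) * t⌋) ⁻¹' {v}) = 0 := by
  refine measure_mono_null ?_ ae_mem_Ico
  intro t ht ht'
  exact hv (Set.mem_singleton_iff.1 ht ▸ floor_mul_mem_Ico hn ht')

/-- The dyadic filtration. -/
noncomputable def dyadicFiltration : Filtration ℕ Real.measurableSpace where
  seq k := MeasurableSpace.comap (fun t : ℝ => ⌊(2 : ℝ) ^ k * t⌋) ⊤
  mono' := by
    refine monotone_nat_of_le_succ fun k => ?_
    rintro _ ⟨T, -, rfl⟩
    refine ⟨(fun v => v / 2) ⁻¹' T, trivial, ?_⟩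
    ext t
    simp [floor_two_pow_succ_ediv]
  le' k := comap_top_le_of_fibers (measurableSet_floor_mul _)

theorem measurableSet_dyadic_fiber (k : ℕ) (v : ℤ) :
    MeasurableSet[dyadicFiltration k] ((fun t : ℝ => ⌊(2 : ℝ) ^ k * t⌋) ⁻¹' {v}) :=
  ⟨{v}, trivial, rfl⟩

variable {X : Type*} [NormedAddCommGroup X]

theorem stronglyMeasurable_dyadic {k : ℕ} {g : ℝ → X}
    (hg : ∀ s t, ⌊(2 : ℝ) ^ k * s⌋ = ⌊(2 : ℝ) ^ k * t⌋ → g s = g t) :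
    StronglyMeasurable[dyadicFiltration k] g := by
  have := stronglyMeasurable_comp_of_fibers (measurableSet_dyadic_fiber k)
    (fun v : ℤ => g (v / 2 ^ k))
  convert this using 1
  ext t
  refine hg _ _ ?_
  rw [mul_div_cancel₀ _ (by positivity), Int.floor_intCast]

theorem stronglyMeasurable_walsh {n k : ℕ} (hn : n < 2 ^ k) :
    StronglyMeasurable[dyadicFiltration k] (walsh n) :=
  stronglyMeasurable_dyadic fun _ _ h => walsh_congr hn h

theorem measurable_walsh (n : ℕ) : Measurable (walsh n) :=
  ((stronglyMeasurable_walsh (Nat.lt_two_pow_self (n := n))).mono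
    (dyadicFiltration.le n)).measurable

variable [NormedSpace ℝ X]

theorem memLp_walsh_smul (n : ℕ) {p : ℝ≥0∞} {g : ℝ → X} (hg : MemLp g p unitMeasure) :
    MemLp (fun t => walsh n t • g t) p unitMeasure := by
  refine MemLp.of_le hg ((measurable_walsh n).aestronglyMeasurable.smul hg.1) ?_
  exact Eventually.of_forall fun t => by rw [norm_smul, Real.norm_eq_abs, abs_walsh, one_mul]

theorem eLpNorm_walsh_smul (n : ℕ) (p : ℝ≥0∞) (g : ℝ → X) :
    eLpNorm (fun t => walsh n t • g t) p unitMeasure = eLpNorm g p unitMeasure :=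
  eLpNorm_congr_norm_ae (Eventually.of_forall fun t => by
    rw [norm_smul, Real.norm_eq_abs, abs_walsh, one_mul])

theorem integrable_walsh_smul (n : ℕ) {g : ℝ → X} (hg : Integrable g unitMeasure) :
    Integrable (fun t => walsh n t • g t) unitMeasure :=
  memLp_one_iff_integrable.1 (memLp_walsh_smul n (memLp_one_iff_integrable.2 hg))

theorem memLp_walshPartialSum (n : ℕ) (g : ℝ → X) (p : ℝ≥0∞) :
    MemLp (walshPartialSum n g) p unitMeasure :=
  memLp_finsetSum _ fun i _ => memLp_walsh_smul i (memLp_const _)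

theorem integrable_walshPartialSum (n : ℕ) (g : ℝ → X) :
    Integrable (walshPartialSum n g) unitMeasure :=
  memLp_one_iff_integrable.1 (memLp_walshPartialSum n g 1)

theorem walshPartialSum_two_pow_congr (k : ℕ) (g : ℝ → X) {s t : ℝ}
    (h : ⌊(2 : ℝ) ^ k * s⌋ = ⌊(2 : ℝ) ^ k * t⌋) :
    walshPartialSum (2 ^ k) g s = walshPartialSum (2 ^ k) g t :=
  Finset.sum_congr rfl fun i hi => by rw [walsh_congr (Finset.mem_range.1 hi) h]

variable [CompleteSpace X]

omit [CompleteSpace X] in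
-- The partial sum integrates `g` against the Dirichlet kernel, which is 2^k on the cell of `t` and
-- 0 on the other cells.
theorem walshPartialSum_two_pow_apply (k : ℕ) {g : ℝ → X} (hg : Integrable g unitMeasure)
    {t : ℝ} (ht : t ∈ Set.Ico (0 : ℝ) 1) :
    walshPartialSum (2 ^ k) g t =
      (2 : ℝ) ^ k • ∫ s in (fun s : ℝ => ⌊(2 : ℝ) ^ k * s⌋) ⁻¹' {⌊(2 : ℝ) ^ k * t⌋},
        g s ∂unitMeasure := by
  have h1 : walshPartialSum (2 ^ k) g t =
      ∫ s, (∑ m ∈ Finset.range (2 ^ k), walsh m s * walsh m t) • g s ∂unitMeasure := by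
    simp only [Finset.sum_smul]
    rw [integral_finsetSum]
    · refine Finset.sum_congr rfl fun m _ => ?_
      rw [walshCoeff, ← integral_smul]
      simp only [smul_smul, mul_comm]
    · intro m _
      have := (integrable_walsh_smul m hg).smul (walsh m t)
      simpa only [Pi.smul_def, smul_smul, mul_comm] using this
  rw [h1, ← integral_smul, ← integral_indicator (measurableSet_floor_mul _ _)]
  refine integral_congr_ae ?_
  filter_upwards [ae_mem_Ico] with s hs
  have h0 : ⌊s⌋ = ⌊t⌋ := by
    rw [Int.floor_eq_zero_iff.2 hs, Int.floor_eq_zero_iff.2 ht]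
  rw [sum_walsh_mul_walsh_eq_ite k h0]
  by_cases h : ⌊(2 : ℝ) ^ k * s⌋ = ⌊(2 : ℝ) ^ k * t⌋ <;> simp [h]

/-- The Walsh partial sums of order `2^k` are the conditional expectations with respect to the
dyadic filtration. -/
theorem walshPartialSum_two_pow_ae_eq_condExp (k : ℕ) {g : ℝ → X}
    (hg : Integrable g unitMeasure) :
    walshPartialSum (2 ^ k) g =ᵐ[unitMeasure] unitMeasure[g | dyadicFiltration k] := by
  refine ae_eq_condExp_comap_of_fibers (measurableSet_floor_mul _) hg
    (integrable_walshPartialSum _ g)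
    (stronglyMeasurable_dyadic fun _ _ => walshPartialSum_two_pow_congr k g).aestronglyMeasurable
    fun v => ?_
  have hn : 0 < 2 ^ k := by positivity
  by_cases hv : v ∈ Finset.Ico (0 : ℤ) ((2 ^ k : ℕ) : ℤ)
  · have h1 := unitMeasure_floor_mul hn hv
    push_cast at h1
    have h2 : ∀ᵐ t ∂(unitMeasure.restrict ((fun t : ℝ => ⌊(2 : ℝ) ^ k * t⌋) ⁻¹' {v})),
        walshPartialSum (2 ^ k) g t = (2 : ℝ) ^ k •
          ∫ s in (fun s : ℝ => ⌊(2 : ℝ) ^ k * s⌋) ⁻¹' {v}, g s ∂unitMeasure := by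
      filter_upwards [ae_restrict_of_ae ae_mem_Ico,
        ae_restrict_mem (measurableSet_floor_mul _ v)] with t ht htv
      rw [walshPartialSum_two_pow_apply k hg ht,
        show ⌊(2 : ℝ) ^ k * t⌋ = v from htv]
    rw [integral_congr_ae h2, integral_const, measureReal_restrict_apply MeasurableSet.univ,
      Set.univ_inter, h1, smul_smul, one_div_mul_cancel (by positivity), one_smul]
  · have h1 := unitMeasure_floor_mul_of_notMem hn hv
    push_cast at h1
    rw [setIntegral_measure_zero _ h1, setIntegral_measure_zero _ h1]

theorem walshPartialSum_two_pow_ae_eq_self {k : ℕ} {g : ℝ → X}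
    (hg : Integrable g unitMeasure)
    (hgm : StronglyMeasurable[dyadicFiltration k] g) :
    walshPartialSum (2 ^ k) g =ᵐ[unitMeasure] g := by
  have := walshPartialSum_two_pow_ae_eq_condExp k hg
  rwa [condExp_of_stronglyMeasurable (dyadicFiltration.le k) hgm hg] at this

theorem eLpNorm_walshPartialSum_two_pow_le (k : ℕ) {g : ℝ → X}
    (hg : Integrable g unitMeasure) {p : ℝ≥0∞} (hp : 1 ≤ p) :
    eLpNorm (walshPartialSum (2 ^ k) g) p unitMeasure ≤ eLpNorm g p unitMeasure :=
  (eLpNorm_congr_ae (walshPartialSum_two_pow_ae_eq_condExp k hg)).trans_le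
    (eLpNorm_condExp_le_eLpNorm g hp)

theorem martingale_walshPartialSum_two_pow {g : ℝ → X} (hg : Integrable g unitMeasure) :
    Martingale (fun k => walshPartialSum (2 ^ k) g) dyadicFiltration unitMeasure := by
  refine (martingale_condExp g dyadicFiltration unitMeasure).congr (fun k => ?_) fun k => ?_
  · exact stronglyMeasurable_dyadic fun _ _ => walshPartialSum_two_pow_congr k g
  · exact (walshPartialSum_two_pow_ae_eq_condExp k hg).symm

/-- The constant 1 equals its partial sum of order 2^n. Integrating gives ∑ (∫ w_i)² = 1; the index
0 already contributes 1, so every other square vanishes. -/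
theorem integral_walsh {n : ℕ} (hn : n ≠ 0) : ∫ t, walsh n t ∂unitMeasure = 0 := by
  have hK : n < 2 ^ n := Nat.lt_two_pow_self
  have h1 : walshPartialSum (2 ^ n) (fun _ => (1 : ℝ)) =ᵐ[unitMeasure] fun _ => 1 :=
    walshPartialSum_two_pow_ae_eq_self (integrable_const _) stronglyMeasurable_const
  have h2 := integral_congr_ae h1
  simp only [walshPartialSum, walshCoeff, smul_eq_mul, mul_one] at h2
  have hint : ∀ i, Integrable (walsh i) unitMeasure := fun i => by
    simpa using integrable_walsh_smul i (integrable_const (1 : ℝ))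
  rw [integral_finsetSum _ fun i _ => (hint i).mul_const _] at h2
  simp only [integral_mul_const, integral_const, probReal_univ, smul_eq_mul, mul_one] at h2
  have h0 : (∫ t, walsh 0 t ∂unitMeasure) = 1 := by simp [walsh_zero]
  have h3 : (0 : ℕ) ∈ Finset.range (2 ^ n) := by simp
  rw [← Finset.add_sum_erase _ _ h3, h0] at h2
  have h4 : ∑ i ∈ (Finset.range (2 ^ n)).erase 0,
      (∫ t, walsh i t ∂unitMeasure) * ∫ t, walsh i t ∂unitMeasure = 0 := by linarith
  rw [Finset.sum_eq_zero_iff_of_nonneg fun i _ => mul_self_nonneg _] at h4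
  exact mul_self_eq_zero.1 (h4 n (by simp [hn, hK]))

omit [CompleteSpace X] in
theorem walshCoeff_congr_ae {f g : ℝ → X} (h : f =ᵐ[unitMeasure] g) (n : ℕ) :
    walshCoeff f n = walshCoeff g n :=
  integral_congr_ae (by filter_upwards [h] with t ht; rw [ht])

omit [CompleteSpace X] in
theorem walshPartialSum_congr_ae {f g : ℝ → X} (h : f =ᵐ[unitMeasure] g) (n : ℕ) :
    walshPartialSum n f = walshPartialSum n g := by
  ext t
  simp only [walshPartialSum, walshCoeff_congr_ae h]

omit [CompleteSpace X] in
theorem walshPartialSum_sub (n : ℕ) {f g : ℝ → X} (hf : Integrable f unitMeasure)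
    (hg : Integrable g unitMeasure) (t : ℝ) : walshPartialSum n (fun s => f s - g s) t =
      walshPartialSum n f t - walshPartialSum n g t := by
  simp only [walshPartialSum, walshCoeff, smul_sub]
  rw [← Finset.sum_sub_distrib]
  refine Finset.sum_congr rfl fun i _ => ?_
  rw [integral_sub (integrable_walsh_smul i hf) (integrable_walsh_smul i hg), smul_sub]

/-- Orthonormality: w_n w_i has index n xor i, hence mean 0 unless i = n. -/
theorem walshCoeff_walshPartialSum (m n : ℕ) (g : ℝ → X) :
    walshCoeff (walshPartialSum m g) n = if n < m then walshCoeff g n else 0 := by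
  have h1 : ∀ i, ∫ t, walsh n t • walsh i t • walshCoeff g i ∂unitMeasure =
      if i = n then walshCoeff g i else 0 := by
    intro i
    simp only [smul_smul, walsh_mul_walsh]
    rw [integral_smul_const]
    split_ifs with h
    · simp [h, walsh_zero]
    · rw [integral_walsh (by rw [Ne, Nat.xor_eq_zero_iff]; exact fun h' => h h'.symm), zero_smul]
  have h2 : walshCoeff (walshPartialSum m g) n =
      ∑ i ∈ Finset.range m, ∫ t, walsh n t • walsh i t • walshCoeff g i ∂unitMeasure := by
    rw [← integral_finsetSum]
    · simp only [walshCoeff, walshPartialSum, Finset.smul_sum]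
    · intro i _
      exact integrable_walsh_smul n (integrable_walsh_smul i (integrable_const _))
  rw [h2]
  simp only [h1, Finset.sum_ite_eq', Finset.mem_range]

theorem walshPartialSum_walshPartialSum {m n : ℕ} (hmn : m ≤ n) (g : ℝ → X) :
    walshPartialSum n (walshPartialSum m g) = walshPartialSum m g := by
  ext t
  simp only [walshPartialSum]
  symm
  simp only [walshCoeff_walshPartialSum]
  rw [← Finset.sum_subset (Finset.range_mono hmn)]
  · refine Finset.sum_congr rfl fun i hi => ?_
    rw [if_pos (Finset.mem_range.1 hi)]
  · intro i _ hi
    rw [if_neg (by simpa using hi), smul_zero]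

end UnitInterval

end WalshUMD

namespace WalshUMD

/-! ### Base-2^m digits as a uniform tree process. -/

section Digits

/-- The last `i` base-`q` digits of an integer, least significant first. -/
def intDigits (q : ℕ) [NeZero q] : ℕ → ℤ → List (Fin q)
  | 0, _ => []
  | i + 1, v => Fin.ofNat q (v % q).toNat :: intDigits q i (v / q)

/-- The integer with the given base-`q` digits, least significant first. -/
def digitsVal (q : ℕ) : List (Fin q) → ℤ
  | [] => 0
  | b :: h => q * digitsVal q h + (b : ℕ)

theorem digitsVal_mem_Ico (q : ℕ) (h : List (Fin q)) :
    digitsVal q h ∈ Finset.Ico (0 : ℤ) ((q ^ h.length : ℕ) : ℤ) := by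
  induction h with
  | nil => simp [digitsVal]
  | cons b h ih =>
    rw [Finset.mem_Ico] at ih ⊢
    have hb : ((b : ℕ) : ℤ) < q := by exact_mod_cast b.2
    have hb0 : (0 : ℤ) ≤ ((b : ℕ) : ℤ) := by positivity
    have hq : (0 : ℤ) < q := hb0.trans_lt hb
    simp only [digitsVal, List.length_cons, pow_succ]
    push_cast at ih ⊢
    constructor <;> nlinarith [ih.1, ih.2]

/-- The digits see `v` only modulo q^i, so the range condition is what makes them determine `v`. -/
theorem intDigits_eq_iff {q : ℕ} [NeZero q] {i : ℕ} {v : ℤ}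
    (hv : v ∈ Finset.Ico (0 : ℤ) ((q ^ i : ℕ) : ℤ)) (h : List (Fin q)) (hh : h.length = i) :
    intDigits q i v = h ↔ v = digitsVal q h := by
  have hq : (0 : ℤ) < q := by exact_mod_cast Nat.pos_of_ne_zero (NeZero.ne q)
  induction i generalizing v h with
  | zero =>
    rw [List.length_eq_zero_iff] at hh
    subst hh
    simp only [intDigits, digitsVal, true_iff]
    simp at hv
    omega
  | succ i ih =>
    obtain ⟨b, h, rfl⟩ := List.exists_cons_of_length_eq_add_one hh
    rw [Finset.mem_Ico] at hv
    have hv' : v / q ∈ Finset.Ico (0 : ℤ) ((q ^ i : ℕ) : ℤ) := by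
      rw [Finset.mem_Ico]
      refine ⟨Int.ediv_nonneg hv.1 hq.le, Int.ediv_lt_of_lt_mul hq ?_⟩
      rw [pow_succ] at hv
      exact_mod_cast hv.2
    have hb : ((b : ℕ) : ℤ) < q := by exact_mod_cast b.2
    have hb0 : (0 : ℤ) ≤ ((b : ℕ) : ℤ) := by positivity
    have hmod0 := Int.emod_nonneg v hq.ne'
    have hmod1 := Int.emod_lt_of_pos v hq
    have hdig : Fin.ofNat q (v % q).toNat = b ↔ v % q = (b : ℕ) := by
      rw [Fin.ext_iff, Fin.val_ofNat, Nat.mod_eq_of_lt (by omega)]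
      omega
    simp only [intDigits, digitsVal, List.cons.injEq]
    have hh' : h.length = i := by simpa using hh
    have hrec : intDigits q i (v / q) = h ↔ v / q = digitsVal q h := ih hv' h hh'
    rw [hrec, hdig]
    have hdm := Int.emod_add_mul_ediv v q
    constructor
    · rintro ⟨h1, h2⟩
      rw [← hdm, h1, h2]; ring
    · rintro rfl
      rw [Int.mul_add_emod_self_left, Int.emod_eq_of_lt hb0 hb,
        Int.mul_add_ediv_left _ _ hq.ne', Int.ediv_eq_zero_of_lt hb0 hb]
      simp

/-- The first `i` base-`2^m` digits of a real number, newest first. -/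
noncomputable def digitHistory (m i : ℕ) (t : ℝ) : List (Fin (2 ^ m)) :=
  intDigits (2 ^ m) i ⌊(2 : ℝ) ^ (m * i) * t⌋

/-- The dyadic filtration observed at multiples of `m`. -/
noncomputable def dyadicFiltrationMul (m : ℕ) : Filtration ℕ Real.measurableSpace where
  seq i := dyadicFiltration (m * i)
  mono' _ _ hij := dyadicFiltration.mono (Nat.mul_le_mul_left m hij)
  le' i := dyadicFiltration.le (m * i)

theorem exists_digitHistory_succ (m i : ℕ) (t : ℝ) :
    ∃ b, digitHistory m (i + 1) t = b :: digitHistory m i t := by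
  refine ⟨Fin.ofNat (2 ^ m) (⌊(2 : ℝ) ^ (m * (i + 1)) * t⌋ % ((2 ^ m : ℕ) : ℤ)).toNat, ?_⟩
  have h := floor_natCast_mul_ediv (2 ^ m) ((2 : ℝ) ^ (m * i) * t)
  simp only [Nat.pow_eq_zero, OfNat.ofNat_ne_zero, false_and, or_false, ne_eq] at h
  rw [digitHistory, intDigits, digitHistory, ← h]
  congr 3
  rw [mul_add, mul_one, pow_add]
  push_cast
  ring_nf

theorem length_digitHistory (m i : ℕ) (t : ℝ) : (digitHistory m i t).length = i := by
  induction i with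
  | zero => rfl
  | succ i ih => obtain ⟨b, hb⟩ := exists_digitHistory_succ m i t; rw [hb]; simp [ih]

theorem digitHistory_eq_iff {m i : ℕ} {t : ℝ} (ht : t ∈ Set.Ico (0 : ℝ) 1)
    (h : List (Fin (2 ^ m))) (hh : h.length = i) :
    digitHistory m i t = h ↔ ⌊(2 : ℝ) ^ (m * i) * t⌋ = digitsVal (2 ^ m) h := by
  refine intDigits_eq_iff ?_ h hh
  have := floor_mul_mem_Ico (n := (2 ^ m) ^ i) (by positivity) ht
  convert this using 3
  push_cast
  rw [pow_mul]

theorem unitMeasure_digitHistory (m i : ℕ) (h : List (Fin (2 ^ m))) :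
    unitMeasure.real (digitHistory m i ⁻¹' {h}) =
      if h.length = i then 1 / ((2 : ℝ) ^ m) ^ i else 0 := by
  split_ifs with hh
  · have h1 : digitHistory m i ⁻¹' {h} =ᵐ[unitMeasure]
        (fun t : ℝ => ⌊(((2 ^ m) ^ i : ℕ) : ℝ) * t⌋) ⁻¹' {digitsVal (2 ^ m) h} := by
      filter_upwards [ae_mem_Ico] with t ht
      refine propext ?_
      change digitHistory m i t = h ↔ ⌊(((2 ^ m) ^ i : ℕ) : ℝ) * t⌋ = digitsVal (2 ^ m) h
      rw [digitHistory_eq_iff ht h hh]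
      push_cast
      rw [pow_mul]
    rw [measureReal_congr h1, unitMeasure_floor_mul (by positivity)]
    · push_cast; rfl
    · have := digitsVal_mem_Ico (2 ^ m) h
      rwa [hh] at this
  · have : digitHistory m i ⁻¹' {h} = ∅ := by
      ext t
      simp only [Set.mem_preimage, Set.mem_singleton_iff, Set.mem_empty_iff_false, iff_false]
      rintro rfl
      exact hh (length_digitHistory m i t)
    simp [this]

/-- Digits of a uniform point are independent and uniform; within [0, 1), the first `i` of them
single out one dyadic cell of level `m * i`, an atom of the filtration. -/
theorem isTreeProcess_digitHistory (m : ℕ) :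
    IsTreeProcess unitMeasure (dyadicFiltrationMul m) (uniformKernel (Fin (2 ^ m)))
      (digitHistory m) where
  zero _ := rfl
  cons := exists_digitHistory_succ m
  meas i h := ⟨intDigits (2 ^ m) i ⁻¹' {h}, trivial, rfl⟩
  atom i S h hS := by
    obtain ⟨T, -, rfl⟩ := hS
    by_cases hh : h.length = i
    · by_cases hT : digitsVal (2 ^ m) h ∈ T
      · right
        refine measure_mono_null ?_ ae_mem_Ico
        rintro t ⟨ht, htS⟩ ht1
        refine htS ?_
        have := (digitHistory_eq_iff ht1 h hh).1 ht
        simpa only [Set.mem_preimage, this] using hT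
      · left
        refine measure_mono_null ?_ ae_mem_Ico
        rintro t ⟨htS, ht⟩ ht1
        have := (digitHistory_eq_iff ht1 h hh).1 ht
        simp only [Set.mem_preimage, this] at htS
        exact hT htS
    · left
      refine measure_mono_null Set.inter_subset_right ?_
      have : digitHistory m i ⁻¹' {h} = ∅ := by
        ext t
        simp only [Set.mem_preimage, Set.mem_singleton_iff, Set.mem_empty_iff_false, iff_false]
        rintro rfl
        exact hh (length_digitHistory m i t)
      simp [this]
  prob i b h := by
    rw [unitMeasure_digitHistory, unitMeasure_digitHistory]
    by_cases hh : h.length = i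
    · simp [hh, uniformKernel, pow_succ]
    · simp [hh]

end Digits

/-! ### Walsh bounds and sign transforms of dyadic martingales. -/

section Signs

variable {X : Type*} [NormedAddCommGroup X] [NormedSpace ℝ X]

/-- The `L₂` boundedness, with constant `c`, of the transforms by signs of the dyadic martingales
generated by square integrable functions on the unit interval. -/
def DyadicSignBound (X : Type*) [NormedAddCommGroup X] [NormedSpace ℝ X] (c : ℝ) : Prop :=
  ∀ g : ℝ → X, MemLp g 2 unitMeasure → ∀ (K : ℕ) (η : ℕ → ℝ), (∀ i, η i = 1 ∨ η i = -1) →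
    eLpNorm (fun t => ∑ k ∈ Finset.range K,
      η k • (walshPartialSum (2 ^ (k + 1)) g t - walshPartialSum (2 ^ k) g t)) 2 unitMeasure ≤
      ENNReal.ofReal c * eLpNorm g 2 unitMeasure

/-- Differences telescope inside a block of constant sign, so a transform at all levels becomes one
of the sequence sampled at multiples of `m`. -/
theorem sum_range_mul_div_smul_sub (m N : ℕ) (ε : ℕ → ℝ) (a : ℕ → X) :
    ∑ k ∈ Finset.range (m * N), ε (k / m) • (a (k + 1) - a k) =
      ∑ i ∈ Finset.range N, ε i • (a (m * (i + 1)) - a (m * i)) := by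
  induction N with
  | zero => simp
  | succ N ih =>
    rw [mul_add, mul_one, Finset.sum_range_add, ih, Finset.sum_range_succ, mul_add, mul_one]
    congr 1
    have htel : ∑ j ∈ Finset.range m, (a (m * N + j + 1) - a (m * N + j)) =
        a (m * N + m) - a (m * N) := Finset.sum_range_sub (fun j => a (m * N + j)) m
    rw [← htel, Finset.smul_sum]
    refine Finset.sum_congr rfl fun j hj => ?_
    have hj := Finset.mem_range.1 hj
    rw [Nat.mul_add_div (by omega), Nat.div_eq_of_lt hj, add_zero]

/-- The digit process realizes the uniform weights on [0, 1]. The sign bound is applied to the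
centred terminal value, with each sign of the tree transform repeated over `m` dyadic levels. -/
theorem DyadicSignBound.treeBound [CompleteSpace X] {c : ℝ} (hc : 0 ≤ c)
    (hb : DyadicSignBound X c) (m : ℕ) : TreeBound X c (uniformKernel (Fin (2 ^ m))) := by
  intro N F ε hε
  have hT := isTreeProcess_digitHistory m
  rw [← hT.eLpNorm_transform_le_iff hc]
  set κ := uniformKernel (Fin (2 ^ m))
  have hF : MemLp (fun t => F (digitHistory m N t)) 2 unitMeasure := hT.memLp N F 2
  have hg : MemLp (fun t => F (digitHistory m N t) - treeMart κ N F []) 2 unitMeasure :=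
    hF.sub (memLp_const _)
  refine le_trans (le_of_eq ?_) (hb _ hg (m * N) (fun k => ε (k / m)) fun k => hε _)
  refine eLpNorm_congr_ae ?_
  have hS : ∀ i ≤ N, walshPartialSum (2 ^ (m * i))
      (fun t => F (digitHistory m N t) - treeMart κ N F []) =ᵐ[unitMeasure]
      fun t => treeMart κ N F (digitHistory m i t) - treeMart κ N F [] := by
    intro i hi
    refine (walshPartialSum_two_pow_ae_eq_condExp (m * i) (hg.integrable one_le_two)).trans ?_
    have h1 : unitMeasure[fun t => F (digitHistory m N t) - treeMart κ N F [] |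
        dyadicFiltration (m * i)] =ᵐ[unitMeasure]
        unitMeasure[fun t => F (digitHistory m N t) | dyadicFiltration (m * i)] -
        unitMeasure[fun _ => treeMart κ N F [] | dyadicFiltration (m * i)] :=
      condExp_sub (hF.integrable one_le_two) (integrable_const _) _
    have h2 : unitMeasure[fun t => F (digitHistory m N t) | dyadicFiltration (m * i)]
        =ᵐ[unitMeasure] fun t => treeMart κ N F (digitHistory m i t) := hT.condExp_treeMart hi F
    rw [condExp_const (dyadicFiltration.le _)] at h1
    filter_upwards [h1, h2] with t h1 h2
    rw [h1, Pi.sub_apply, h2]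
  have hS' : ∀ᵐ t ∂unitMeasure, ∀ i ≤ N, walshPartialSum (2 ^ (m * i))
      (fun t => F (digitHistory m N t) - treeMart κ N F []) t =
      treeMart κ N F (digitHistory m i t) - treeMart κ N F [] := by
    rw [ae_all_iff]; intro i
    rw [ae_all_iff]; exact hS i
  filter_upwards [hS'] with t ht
  rw [sum_range_mul_div_smul_sub m N ε fun k => walshPartialSum (2 ^ k)
      (fun t => F (digitHistory m N t) - treeMart κ N F []) t]
  refine Finset.sum_congr rfl fun i hi => ?_
  have hi := Finset.mem_range.1 hi
  rw [ht (i + 1) hi, ht i hi.le, sub_sub_sub_cancel_right]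

/-- The uniform `L₂` boundedness of the Walsh partial sums, with constant `c`. -/
def WalshBound (X : Type*) [NormedAddCommGroup X] [NormedSpace ℝ X] (c : ℝ) : Prop :=
  ∀ g : ℝ → X, MemLp g 2 unitMeasure → ∀ n : ℕ,
    eLpNorm (walshPartialSum n g) 2 unitMeasure ≤ ENNReal.ofReal c * eLpNorm g 2 unitMeasure

theorem memLp_sum_smul_walshPartialSum_sub (g : ℝ → X) (K : ℕ) (η : ℕ → ℝ) :
    MemLp (fun t => ∑ k ∈ Finset.range K,
      η k • (walshPartialSum (2 ^ (k + 1)) g t - walshPartialSum (2 ^ k) g t)) 2 unitMeasure :=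
  memLp_finsetSum _ fun k _ =>
    ((memLp_walshPartialSum _ g 2).sub (memLp_walshPartialSum _ g 2)).const_smul (η k)

/-- Let n have digit 1 exactly where the sign is +1. From η_k = 2 n_k - 1, the transform is 2 w_n
S_n(w_n g) - (S_{2^K} g - S_1 g). The first term has constant 2c, and the two contractions add 2. -/
theorem WalshBound.dyadicSignBound [CompleteSpace X] {c : ℝ} (hc : 0 ≤ c)
    (hb : WalshBound X c) : DyadicSignBound X (2 * c + 2) := by
  classical
  intro g hg K η hη
  let n := Nat.ofBits (fun i : Fin K => decide (η i = 1))
  have hn : n < 2 ^ K := Nat.ofBits_lt_two_pow _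
  have hbit : ∀ k < K, n.testBit k = decide (η k = 1) := fun k hk => Nat.testBit_ofBits_lt _ k hk
  let f : ℝ → X := fun s => walsh n s • g s
  have hf : MemLp f 2 unitMeasure := memLp_walsh_smul n hg
  have hsplit : (fun t => ∑ k ∈ Finset.range K,
      η k • (walshPartialSum (2 ^ (k + 1)) g t - walshPartialSum (2 ^ k) g t)) =
      (2 : ℝ) • (fun t => walsh n t • walshPartialSum n f t) -
        (walshPartialSum (2 ^ K) g - walshPartialSum (2 ^ 0) g) := by
    ext t
    simp only [Pi.sub_apply, Pi.smul_apply]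
    rw [walsh_smul_walshPartialSum g hn t,
      ← Finset.sum_range_sub (fun k => walshPartialSum (2 ^ k) g t) K, Finset.smul_sum,
      ← Finset.sum_sub_distrib]
    refine Finset.sum_congr rfl fun k hk => ?_
    rw [hbit k (Finset.mem_range.1 hk)]
    rcases hη k with h | h
    · simp only [h, decide_true, if_true, two_smul, one_smul]; abel
    · have : ¬ ((-1 : ℝ) = 1) := by norm_num
      simp only [h, this, decide_false, neg_smul, one_smul]
      simp
  have hgi := hg.integrable one_le_two
  have hfm : MemLp (fun t => walsh n t • walshPartialSum n f t) 2 unitMeasure :=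
    memLp_walsh_smul n (memLp_walshPartialSum n f 2)
  rw [hsplit]
  refine (eLpNorm_sub_le (hfm.1.const_smul _) ((memLp_walshPartialSum _ g 2).1.sub
    (memLp_walshPartialSum _ g 2).1) one_le_two).trans ?_
  have h1 : eLpNorm ((2 : ℝ) • (fun t => walsh n t • walshPartialSum n f t)) 2 unitMeasure ≤
      ENNReal.ofReal (2 * c) * eLpNorm g 2 unitMeasure := by
    rw [eLpNorm_const_smul, eLpNorm_walsh_smul, ENNReal.ofReal_mul zero_le_two, mul_assoc]
    refine mul_le_mul' (Real.enorm_eq_ofReal zero_le_two).le ((hb f hf n).trans (le_of_eq ?_))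
    rw [eLpNorm_walsh_smul]
  have h2 : eLpNorm (walshPartialSum (2 ^ K) g - walshPartialSum (2 ^ 0) g) 2 unitMeasure ≤
      ENNReal.ofReal 2 * eLpNorm g 2 unitMeasure := by
    refine (eLpNorm_sub_le (memLp_walshPartialSum _ g 2).1
      (memLp_walshPartialSum _ g 2).1 one_le_two).trans ?_
    refine (add_le_add (eLpNorm_walshPartialSum_two_pow_le K hgi one_le_two)
      (eLpNorm_walshPartialSum_two_pow_le 0 hgi one_le_two)).trans (le_of_eq ?_)
    rw [← two_mul]; simp
  refine (add_le_add h1 h2).trans (le_of_eq ?_)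
  rw [← add_mul, ENNReal.ofReal_add (by positivity) zero_le_two]

/-- Since n_k = (η_k + 1)/2, the modulated partial sum is the average of two sign transforms, so the
constant is unchanged. As n < 2^n, n digits suffice. -/
theorem DyadicSignBound.walshBound {c : ℝ} (hb : DyadicSignBound X c) : WalshBound X c := by
  intro f hf n
  have hn : n < 2 ^ n := Nat.lt_two_pow_self
  let g : ℝ → X := fun s => walsh n s • f s
  have hg : MemLp g 2 unitMeasure := memLp_walsh_smul n hf
  have hgf : (fun s => walsh n s • g s) = f := by
    ext s; simp only [g, smul_smul, walsh_mul_self, one_smul]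
  rw [← eLpNorm_walsh_smul]
  let η : ℕ → ℝ := fun k => if n.testBit k then 1 else -1
  have hη : ∀ k, η k = 1 ∨ η k = -1 := by intro k; simp only [η]; split_ifs <;> simp
  have hsplit : (fun t => walsh n t • walshPartialSum n f t) = (1 / 2 : ℝ) •
      ((fun t => ∑ k ∈ Finset.range n,
        η k • (walshPartialSum (2 ^ (k + 1)) g t - walshPartialSum (2 ^ k) g t)) +
      fun t => ∑ k ∈ Finset.range n,
        (1 : ℝ) • (walshPartialSum (2 ^ (k + 1)) g t - walshPartialSum (2 ^ k) g t)) := by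
    ext t
    have := walsh_smul_walshPartialSum g hn t
    rw [hgf] at this
    simp only [Pi.add_apply, Pi.smul_apply]
    rw [this, ← Finset.sum_add_distrib, Finset.smul_sum]
    refine Finset.sum_congr rfl fun k _ => ?_
    rw [← add_smul, smul_smul]
    by_cases h : n.testBit k
    · simp [η, h]; norm_num
    · simp [η, h]
  rw [hsplit, eLpNorm_const_smul]
  have h1 := hb g hg n η hη
  have h2 := hb g hg n (fun _ => 1) (fun _ => Or.inl rfl)
  have h3 := (eLpNorm_add_le (memLp_sum_smul_walshPartialSum_sub g n η).1
    (memLp_sum_smul_walshPartialSum_sub g n fun _ => 1).1 one_le_two).trans (add_le_add h1 h2)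
  refine (mul_le_mul_right h3 _).trans (le_of_eq ?_)
  rw [eLpNorm_walsh_smul, ← two_mul, ← mul_assoc]
  have : ‖(1 / 2 : ℝ)‖ₑ * 2 = 1 := by
    rw [Real.enorm_eq_ofReal (by norm_num), ← ENNReal.ofReal_ofNat 2,
      ← ENNReal.ofReal_mul (by norm_num)]
    norm_num
  rw [this, one_mul]

end Signs

end WalshUMD

namespace WalshUMD

/-! ### Convergence in L₂ and uniform boundedness. -/

section Convergence

variable {X : Type*} [NormedAddCommGroup X] [NormedSpace ℝ X]

theorem norm_walshCoeff_le [CompleteSpace X] {g : ℝ → X} (hg : MemLp g 2 unitMeasure) (n : ℕ) :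
    ENNReal.ofReal ‖walshCoeff g n‖ ≤ eLpNorm g 2 unitMeasure := by
  rw [ofReal_norm, walshCoeff]
  refine (enorm_integral_le_lintegral_enorm _).trans ?_
  rw [← eLpNorm_one_eq_lintegral_enorm, eLpNorm_walsh_smul]
  exact eLpNorm_le_eLpNorm_of_exponent_le one_le_two hg.1

/-- The Walsh partial sum of order `n` as a continuous linear map on `L₂`. -/
noncomputable def walshPartialSumL (X : Type*) [NormedAddCommGroup X] [NormedSpace ℝ X]
    [CompleteSpace X] (n : ℕ) : Lp X 2 unitMeasure →L[ℝ] Lp X 2 unitMeasure :=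
  LinearMap.mkContinuousOfExistsBound
    { toFun := fun f => (memLp_walshPartialSum n f 2).toLp _
      map_add' := fun f g => by
        rw [← MemLp.toLp_add, MemLp.toLp_eq_toLp_iff]
        refine Eventually.of_forall fun t => ?_
        have hf := (Lp.memLp f).integrable one_le_two
        have hg := (Lp.memLp g).integrable one_le_two
        rw [walshPartialSum_congr_ae (Lp.coeFn_add f g)]
        simp only [walshPartialSum, walshCoeff, Pi.add_apply, smul_add]
        rw [← Finset.sum_add_distrib]
        refine Finset.sum_congr rfl fun i _ => ?_
        rw [integral_add (integrable_walsh_smul i hf) (integrable_walsh_smul i hg), smul_add]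
      map_smul' := fun c f => by
        rw [RingHom.id_apply, ← MemLp.toLp_const_smul, MemLp.toLp_eq_toLp_iff]
        refine Eventually.of_forall fun t => ?_
        rw [walshPartialSum_congr_ae (Lp.coeFn_smul c f)]
        have hc : ∀ i, walshCoeff (c • (f : ℝ → X)) i = c • walshCoeff f i := fun i => by
          rw [walshCoeff, walshCoeff, ← integral_smul]
          simp only [Pi.smul_apply, smul_comm c]
        simp only [walshPartialSum, hc, Pi.smul_apply, Finset.smul_sum, smul_comm c] } <| by
    -- A crude bound, needed only for continuity: each of the `n` terms has norm at most that of
    -- `f`.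
    refine ⟨n, fun f => ?_⟩
    change ‖(memLp_walshPartialSum n f 2).toLp _‖ ≤ _
    rw [Lp.norm_toLp, Lp.norm_def]
    refine ENNReal.toReal_le_of_le_ofReal (by positivity) ?_
    rw [ENNReal.ofReal_mul (by positivity), ENNReal.ofReal_toReal (Lp.memLp f).2.ne]
    have h1 : walshPartialSum n f =
        ∑ i ∈ Finset.range n, fun t => walsh i t • walshCoeff f i := by
      ext t; simp [walshPartialSum]
    rw [h1]
    refine (eLpNorm_sum_le (fun i _ => (memLp_walsh_smul i (memLp_const (p := 2) _)).1)
      one_le_two).trans ?_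
    refine (Finset.sum_le_sum (g := fun _ => eLpNorm f 2 unitMeasure) fun i _ => ?_).trans
      (le_of_eq ?_)
    · rw [eLpNorm_walsh_smul, eLpNorm_const _ two_ne_zero (IsProbabilityMeasure.ne_zero _)]
      simpa using norm_walshCoeff_le (Lp.memLp f) i
    · simp

/-- Pointwise convergence of the Walsh partial sums in `L₂` implies their uniform
boundedness. -/
theorem exists_walshBound [CompleteSpace X]
    (h : ∀ f : ℝ → X, MemLp f 2 unitMeasure →
      Tendsto (fun n : ℕ => eLpNorm (fun t => f t - walshPartialSum n f t) 2 unitMeasure)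
        atTop (𝓝 0)) : ∃ c : ℝ, 0 ≤ c ∧ WalshBound X c := by
  have hpt : ∀ f : Lp X 2 unitMeasure, ∃ C, ∀ n, ‖walshPartialSumL X n f‖ ≤ C := by
    intro f
    have hlim : Tendsto (fun n => walshPartialSumL X n f) atTop (𝓝 f) := by
      rw [tendsto_iff_edist_tendsto_0]
      refine (h f (Lp.memLp f)).congr fun n => ?_
      rw [edist_comm, Lp.edist_def]
      refine eLpNorm_congr_ae ?_
      have : walshPartialSumL X n f =ᵐ[unitMeasure] walshPartialSum n f :=
        (memLp_walshPartialSum n f 2).coeFn_toLp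
      filter_upwards [this] with t ht
      rw [Pi.sub_apply, ht]
    obtain ⟨C, hC⟩ := hlim.norm.bddAbove_range
    exact ⟨C, fun n => hC ⟨n, rfl⟩⟩
  obtain ⟨C, hC⟩ := banach_steinhaus hpt
  have hC0 : 0 ≤ C := (norm_nonneg _).trans (hC 0)
  refine ⟨C, hC0, fun g hg n => ?_⟩
  have h1 := (walshPartialSumL X n).le_of_opNorm_le (hC n) (hg.toLp g)
  have h2 : walshPartialSumL X n (hg.toLp g) = (memLp_walshPartialSum n g 2).toLp _ := by
    change (memLp_walshPartialSum n (hg.toLp g) 2).toLp _ = _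
    rw [MemLp.toLp_eq_toLp_iff, walshPartialSum_congr_ae hg.coeFn_toLp]
  rw [h2, Lp.norm_toLp, Lp.norm_toLp] at h1
  rw [← ENNReal.ofReal_toReal (memLp_walshPartialSum n g 2).2.ne,
    ← ENNReal.ofReal_toReal hg.2.ne, ← ENNReal.ofReal_mul hC0]
  exact ENNReal.ofReal_le_ofReal h1

/-- Square integrable functions are approximated by functions which are measurable with respect
to some dyadic σ-algebra. -/
theorem exists_dyadic_eLpNorm_sub_le {f : ℝ → X} (hf : MemLp f 2 unitMeasure) {δ : ℝ}
    (hδ : 0 < δ) : ∃ (k : ℕ) (g : ℝ → X), MemLp g 2 unitMeasure ∧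
      StronglyMeasurable[dyadicFiltration k] g ∧
      eLpNorm (fun t => f t - g t) 2 unitMeasure ≤ ENNReal.ofReal δ := by
  have hδ2 : 0 < δ / 2 := by positivity
  have : unitMeasure.WeaklyRegular := by unfold unitMeasure; infer_instance
  obtain ⟨h, hfh, hh⟩ := hf.exists_boundedContinuous_eLpNorm_sub_le (by norm_num)
    (ENNReal.ofReal_pos.2 hδ2).ne'
  have huc : UniformContinuousOn h (Set.Icc 0 1) :=
    isCompact_Icc.uniformContinuousOn_of_continuous h.continuous.continuousOn
  rw [Metric.uniformContinuousOn_iff] at huc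
  obtain ⟨η, hη, huc⟩ := huc (δ / 2) hδ2
  obtain ⟨k, hk⟩ := exists_pow_lt_of_lt_one hη (by norm_num : (1 / 2 : ℝ) < 1)
  have h2k : (0 : ℝ) < 2 ^ k := by positivity
  -- The continuous approximant is sampled at the left endpoint of each dyadic cell; uniform
  -- continuity on [0, 1] controls the error.
  let g : ℝ → X := fun t => h (⌊(2 : ℝ) ^ k * t⌋ / 2 ^ k)
  have hgm : StronglyMeasurable[dyadicFiltration k] g :=
    stronglyMeasurable_dyadic fun s t hst => by simp only [g, hst]
  have hg : MemLp g 2 unitMeasure :=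
    MemLp.of_bound (hgm.mono (dyadicFiltration.le k)).aestronglyMeasurable ‖h‖
      (Eventually.of_forall fun t => h.norm_coe_le_norm _)
  refine ⟨k, g, hg, hgm, ?_⟩
  have hhg : eLpNorm (fun t => h t - g t) 2 unitMeasure ≤ ENNReal.ofReal (δ / 2) := by
    refine (eLpNorm_le_of_ae_bound (C := δ / 2) ?_).trans (le_of_eq (by simp))
    filter_upwards [ae_mem_Ico] with t ht
    rw [← dist_eq_norm]
    refine (huc t ⟨ht.1, ht.2.le⟩ _ ?_ ?_).le
    · have h0 : (0 : ℝ) ≤ ⌊(2 : ℝ) ^ k * t⌋ := by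
        exact_mod_cast Int.floor_nonneg.2 (mul_nonneg h2k.le ht.1)
      refine ⟨by positivity, ?_⟩
      rw [div_le_one h2k]
      nlinarith [Int.floor_le ((2 : ℝ) ^ k * t), ht.2]
    · have h1 := Int.floor_le ((2 : ℝ) ^ k * t)
      have h2 := Int.lt_floor_add_one ((2 : ℝ) ^ k * t)
      have h3 : t - ⌊(2 : ℝ) ^ k * t⌋ / 2 ^ k = ((2 : ℝ) ^ k * t - ⌊(2 : ℝ) ^ k * t⌋) / 2 ^ k := by
        field_simp
      rw [Real.dist_eq, h3, abs_of_nonneg (div_nonneg (by linarith) h2k.le)]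
      refine lt_trans ?_ hk
      rw [one_div, inv_pow, ← one_div]
      exact div_lt_div_of_pos_right (by linarith) h2k
  have hsplit : (fun t => f t - g t) = (f - h) + fun t => h t - g t := by
    ext t; simp
  rw [hsplit]
  refine (eLpNorm_add_le (hf.1.sub hh.1) (hh.1.sub hg.1) one_le_two).trans ?_
  refine (add_le_add hfh hhg).trans (le_of_eq ?_)
  rw [← ENNReal.ofReal_add hδ2.le hδ2.le, add_halves]

/-- Uniform boundedness of the Walsh partial sums implies their convergence in `L₂`. -/
theorem WalshBound.tendsto [CompleteSpace X] {c : ℝ} (hc : 0 ≤ c) (hb : WalshBound X c)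
    {f : ℝ → X} (hf : MemLp f 2 unitMeasure) :
    Tendsto (fun n : ℕ => eLpNorm (fun t => f t - walshPartialSum n f t) 2 unitMeasure)
      atTop (𝓝 0) := by
  rw [ENNReal.tendsto_nhds_zero]
  intro η hη
  obtain ⟨ρ, hρ0, hρ⟩ : ∃ ρ : ℝ, 0 < ρ ∧ ENNReal.ofReal ρ ≤ η := by
    rcases eq_or_ne η ⊤ with rfl | htop
    · exact ⟨1, one_pos, le_top⟩
    · exact ⟨η.toReal, ENNReal.toReal_pos hη.ne' htop, ENNReal.ofReal_toReal_le⟩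
  -- The final error is (f - g) - S_n(f - g), of norm at most (1 + c) times that of f - g.
  have hδ : 0 < ρ / (1 + c) := by positivity
  obtain ⟨k, g, hg, hgm, hfg⟩ := exists_dyadic_eLpNorm_sub_le hf hδ
  have hgi := hg.integrable one_le_two
  have hself := walshPartialSum_two_pow_ae_eq_self hgi hgm
  filter_upwards [eventually_ge_atTop (2 ^ k)] with n hn
  have hSg : walshPartialSum n g =ᵐ[unitMeasure] g := by
    rw [walshPartialSum_congr_ae hself.symm, walshPartialSum_walshPartialSum hn]
    exact hself
  have hfgm : MemLp (fun t => f t - g t) 2 unitMeasure := hf.sub hg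
  have hae : (fun t => f t - walshPartialSum n f t) =ᵐ[unitMeasure]
      (fun t => f t - g t) - walshPartialSum n (fun t => f t - g t) := by
    filter_upwards [hSg] with t ht
    rw [Pi.sub_apply, walshPartialSum_sub n (hf.integrable one_le_two) hgi, ht]
    abel
  rw [eLpNorm_congr_ae hae]
  refine (eLpNorm_sub_le hfgm.1 (memLp_walshPartialSum n _ 2).1 one_le_two).trans ?_
  refine (add_le_add hfg ((hb _ hfgm n).trans (mul_le_mul_right hfg _))).trans
    (le_trans (le_of_eq ?_) hρ)
  rw [← ENNReal.ofReal_mul hc, ← ENNReal.ofReal_add hδ.le (by positivity)]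
  congr 1
  field_simp

end Convergence

/-! ### From UMD to dyadic sign transforms. -/

section UMD

/-- Used to move the dyadic martingale to a lift of ℝ, because the UMD property quantifies over
probability spaces in a prescribed universe. -/
theorem martingale_comp_measurePreserving {X : Type*} [NormedAddCommGroup X] [NormedSpace ℝ X]
    [CompleteSpace X] {Ω Ω' : Type*} {mΩ : MeasurableSpace Ω} {mΩ' : MeasurableSpace Ω'}
    {P : Measure Ω} {P' : Measure Ω'} [IsFiniteMeasure P] [IsFiniteMeasure P'] {T : Ω' → Ω}
    (hT : MeasurePreserving T P' P) {ℱ : Filtration ℕ mΩ} {ℱ' : Filtration ℕ mΩ'}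
    (hℱ : ∀ i, ℱ' i = MeasurableSpace.comap T (ℱ i)) {M : ℕ → Ω → X} (hM : Martingale M ℱ P) :
    Martingale (fun i ω => M i (T ω)) ℱ' P' := by
  have hmeas : ∀ i, @Measurable _ _ (ℱ' i) (ℱ i) T := fun i => by
    rw [hℱ i]; exact comap_measurable T
  have hint : ∀ i, Integrable (fun ω => M i (T ω)) P' := fun i =>
    hT.integrable_comp_of_integrable (hM.integrable i)
  have hsm : ∀ i, StronglyMeasurable[ℱ' i] (fun ω => M i (T ω)) := fun i =>
    (hM.stronglyMeasurable i).comp_measurable (hmeas i)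
  refine ⟨hsm, fun i j hij => ?_⟩
  symm
  refine ae_eq_condExp_of_forall_setIntegral_eq (ℱ'.le i) (hint j)
    (fun s _ _ => (hint i).integrableOn) ?_ (hsm i).aestronglyMeasurable
  intro s hs _
  rw [hℱ i] at hs
  obtain ⟨S, hS, rfl⟩ := hs
  have key : ∀ l, ∫ ω in T ⁻¹' S, M l (T ω) ∂P' = ∫ ω in S, M l ω ∂P := by
    intro l
    rw [← hT.map_eq, setIntegral_map (ℱ.le i _ hS)]
    · rw [hT.map_eq]; exact (hM.integrable l).1
    · exact hT.aemeasurable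
  rw [key, key, hM.setIntegral_eq hij hS]

/-- UMD bounds the transform by the norm of S_{2^K} g - S_1 g; both terms are contractions of g,
whence the factor 2. -/
theorem HasUMD.exists_dyadicSignBound {X : Type u} [NormedAddCommGroup X] [NormedSpace ℝ X]
    [CompleteSpace X] (h : HasUMD.{u, v} X) : ∃ c : ℝ, 0 ≤ c ∧ DyadicSignBound X c := by
  obtain ⟨c, hc⟩ := h
  refine ⟨c * 2, by positivity, fun g hg K η hη => ?_⟩
  -- The sums in `HasUMD` have `n + 1` terms, so the empty sum is treated apart.
  rcases K with _ | n
  · simp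
  have hgi := hg.integrable one_le_two
  let P' : Measure (ULift.{v} ℝ) := unitMeasure.map ULift.up
  have hup : MeasurePreserving (ULift.up : ℝ → ULift.{v} ℝ) unitMeasure P' :=
    ⟨measurable_up, rfl⟩
  have hdown : MeasurePreserving (ULift.down : ULift.{v} ℝ → ℝ) P' unitMeasure := by
    refine ⟨measurable_down, ?_⟩
    rw [Measure.map_map measurable_down measurable_up]
    exact Measure.map_id
  have : IsProbabilityMeasure P' := Measure.isProbabilityMeasure_map measurable_up.aemeasurable
  let ℱ' : Filtration ℕ (inferInstance : MeasurableSpace (ULift.{v} ℝ)) :=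
    { seq := fun i => MeasurableSpace.comap ULift.down (dyadicFiltration i)
      mono' := fun i j hij => MeasurableSpace.comap_mono (dyadicFiltration.mono hij)
      le' := fun i => (MeasurableSpace.comap_mono (dyadicFiltration.le i)).trans
        measurable_down.comap_le }
  have hM := martingale_comp_measurePreserving (ℱ' := ℱ') hdown (fun _ => rfl)
    (martingale_walshPartialSum_two_pow hgi)
  have key := hc (ULift.{v} ℝ) _ P' this ℱ' _ hM η hη n
  have hsum : ∀ t, ∑ i ∈ Finset.range (n + 1),
      (walshPartialSum (2 ^ (i + 1)) g t - walshPartialSum (2 ^ i) g t) =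
      (walshPartialSum (2 ^ (n + 1)) g - walshPartialSum (2 ^ 0) g) t := fun t =>
    Finset.sum_range_sub (fun i => walshPartialSum (2 ^ i) g t) (n + 1)
  simp only [hsum] at key
  have h1 := eLpNorm_comp_measurePreserving (p := 2)
    (memLp_sum_smul_walshPartialSum_sub g (n + 1) η).1 hdown
  have hsub : MemLp (walshPartialSum (2 ^ (n + 1)) g - walshPartialSum (2 ^ 0) g) 2 unitMeasure :=
    (memLp_walshPartialSum _ g 2).sub (memLp_walshPartialSum _ g 2)
  have h2 := eLpNorm_comp_measurePreserving (p := 2) hsub.1 hdown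
  simp only [Function.comp_def] at h1 h2
  rw [h1, h2] at key
  refine key.trans ?_
  rw [ENNReal.ofReal_mul c.coe_nonneg, ENNReal.ofReal_coe_nnreal, mul_assoc]
  refine mul_le_mul' le_rfl ?_
  refine (eLpNorm_sub_le (memLp_walshPartialSum _ g 2).1
    (memLp_walshPartialSum _ g 2).1 one_le_two).trans ?_
  refine (add_le_add (eLpNorm_walshPartialSum_two_pow_le _ hgi one_le_two)
    (eLpNorm_walshPartialSum_two_pow_le 0 hgi one_le_two)).trans (le_of_eq ?_)
  rw [← two_mul]; simp

end UMD

end WalshUMD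

theorem mainTheorem2 (X : Type u) [NormedAddCommGroup X] [NormedSpace ℝ X] [CompleteSpace X] :
    (∀ f : ℝ → X, MemLp f 2 WalshUMD.unitMeasure →
        Tendsto (fun n : ℕ => eLpNorm (fun t => f t - WalshUMD.walshPartialSum n f t) 2
          WalshUMD.unitMeasure) atTop (𝓝 0)) ↔
      WalshUMD.HasUMD.{u, v} X := by
  constructor
  · intro h
    obtain ⟨c, hc, hb⟩ := WalshUMD.exists_walshBound h
    have hc' : 0 ≤ 2 * c + 2 := by positivity
    exact WalshUMD.hasUMD_of_treeBound hc' fun A _ κ hκ hκ1 =>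
      WalshUMD.TreeBound.of_uniformKernel (fun m => (hb.dyadicSignBound hc).treeBound hc' m) hκ hκ1
  · intro h f hf
    obtain ⟨c, hc, hb⟩ := h.exists_dyadicSignBound
    exact hb.walshBound.tendsto hc hf
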